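/- Let $\Omega\subset\mathbb R^2$ be a bounded open set with Lipschitz boundary, let $1<p<\infty$, $q=p'=\frac{p}{p-1}$ and $\Lambda>0$. Let $p^*=\frac{2p}{2-p}$ if $p<2$, let $p^*\in[1,\infty)$ be arbitrary if $p=2$, let $p^*=\infty$ if $p>2$, and let $f\in L^{(p^*)'}(\Omega)$, where $(p^*)'$ is the conjugate exponent of $p^*$. Let $\mathcal K$ be the set of nonempty closed connected subsets of $\overline\Omega$. For $K\in\mathcal K$ let $W^{1,p}_K(\Omega)$ be the closure in $W^{1,p}(\Omega)$ of the (restrictions to $\Omega$ of the) functions in $C^\infty_c(\mathbb R^2\setminus K)$, and let $u_K$ denote any solution, if one exists, of $$\min\Big\{\int_\Omega\Big(\frac1p|\nabla u|^p-uf\Big)\,dx\;:\;u\in W^{1,p}_K(\Omega)\Big\}.$$ Let $\mathcal A_p$ be the set of pairs $(K,v)$ with $K\in\mathcal K$, $v\in L^q(\Omega;\mathbb R^2)$ and $\int_\Omega v\cdot\nabla\psi\,dx=\int_\Omega\psi f\,dx$ for every $\psi\in C^1(\overline\Omega)$ (restriction to $\overline\Omega$ of a $C^1$ function on $\mathbb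 R^2$) with $\psi=0$ on $K$. Consider the $p$-compliance problem $$\inf\Big\{\frac{p-1}{p}\int_\Omega u_Kf\,dx+\Lambda\mathcal H^1(K)\;:\;K\in\mathcal K\Big\}\qquad(1)$$ (sets $K$ for which no $u_K$ exists do not compete, and $\inf\emptyset=+\infty$) and the problem $$\inf\Big\{\frac1q\int_\Omega|v|^q\,dx+\Lambda\mathcal H^1(K)\;:\;(K,v)\in\mathcal A_p\Big\}.\qquad(2)$$ Then (1) and (2) are equivalent, in the following sense. The two infima are equal in $[-\infty,+\infty]$. A set $K$ solves (1) if and only if there is a $v$ such that $(K,v)$ solves (2). Moreover, for every $K\in\mathcal K$, a solution $u_K$ exists if and only if $(K,v)\in\mathcal A_p$ for some $v$, and in that case, for every solution $u_K$, $$\frac{p-1}{p}\int_\Omega u_Kf\,dx=\min\Big\{\frac1q\int_\Omega|v|^q\,dx\;:\;(K,v)\in\mathcal A_p\Big\}.$$ -/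

import Mathlib

open MeasureTheory Set
open scoped ENNReal NNReal ContDiff

noncomputable section

/-- The Euclidean plane `ℝ²`. -/
abbrev Plane : Type := EuclideanSpace ℝ (Fin 2)

/-- `Ω` has Lipschitz boundary: near each boundary point, in suitable orthonormal coordinates
(given by the linear isometry `e`), `Ω` is the set of points above the graph of a Lipschitz
function. -/
def HasLipschitzBoundary (Ω : Set Plane) : Prop :=
  ∀ x₀ ∈ frontier Ω, ∃ (e : Plane ≃ₗᵢ[ℝ] Plane) (g : ℝ → ℝ) (L : ℝ≥0) (r : ℝ),
    0 < r ∧ LipschitzWith L g ∧ ∀ x ∈ Metric.ball x₀ r, (x ∈ Ω ↔ g (e x 0) < e x 1)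

/-- `r` is an exponent `p^*` of the Sobolev injection `W^{1,p} ⊂ L^{p^*}` in the plane:
`2p/(2-p)` if `p < 2`, any finite exponent if `p = 2`, and `∞` if `p > 2`. -/
def IsSobolevExponent (p : ℝ) (r : ℝ≥0∞) : Prop :=
  (p < 2 ∧ r = ENNReal.ofReal (2 * p / (2 - p))) ∨ (p = 2 ∧ r < ⊤) ∨ (2 < p ∧ r = ⊤)

/-- `G` is the weak gradient of `u` in the open set `Ω`. -/
def HasWeakGradient (Ω : Set Plane) (u : Plane → ℝ) (G : Plane → Plane) : Prop :=
  ∀ φ : Plane → ℝ, ContDiff ℝ ∞ φ → HasCompactSupport φ → tsupport φ ⊆ Ω →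
    ∫ x in Ω, u x • gradient φ x = -∫ x in Ω, φ x • G x

/-- `u ∈ W^{1,p}(Ω)` with weak gradient `G`. -/
def MemW1p (Ω : Set Plane) (p : ℝ) (u : Plane → ℝ) (G : Plane → Plane) : Prop :=
  MemLp u (ENNReal.ofReal p) (volume.restrict Ω) ∧
    MemLp G (ENNReal.ofReal p) (volume.restrict Ω) ∧ HasWeakGradient Ω u G

/-- `u ∈ W^{1,p}_K(Ω)`, with weak gradient `G`: the function `u` belongs to the closure in
`W^{1,p}(Ω)` of the restrictions to `Ω` of the functions in `C^∞_c(ℝ² ∖ K)`. -/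
def MemW1pVanishing (Ω K : Set Plane) (p : ℝ) (u : Plane → ℝ) (G : Plane → Plane) : Prop :=
  MemW1p Ω p u G ∧ ∀ ε : ℝ≥0∞, 0 < ε → ∃ φ : Plane → ℝ,
    ContDiff ℝ ∞ φ ∧ HasCompactSupport φ ∧ Disjoint (tsupport φ) K ∧
    eLpNorm (fun x => u x - φ x) (ENNReal.ofReal p) (volume.restrict Ω) < ε ∧
    eLpNorm (fun x => G x - gradient φ x) (ENNReal.ofReal p) (volume.restrict Ω) < ε

/-- The energy `∫_Ω (|∇u|^p / p - u f)`, where `G = ∇u`. -/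
def dirichletEnergy (Ω : Set Plane) (p : ℝ) (f u : Plane → ℝ) (G : Plane → Plane) : ℝ :=
  ∫ x in Ω, (1 / p * ‖G x‖ ^ p - u x * f x)

/-- `u`, with weak gradient `G`, is a solution `u_K` of the problem
`min { ∫_Ω (|∇w|^p / p - w f) ; w ∈ W^{1,p}_K(Ω) }`. -/
def IsPotential (Ω K : Set Plane) (p : ℝ) (f u : Plane → ℝ) (G : Plane → Plane) : Prop :=
  MemW1pVanishing Ω K p u G ∧
    ∀ (w : Plane → ℝ) (H : Plane → Plane), MemW1pVanishing Ω K p w H →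
      dirichletEnergy Ω p f u G ≤ dirichletEnergy Ω p f w H

/-- The class `𝒦` of (nonempty) closed connected subsets of the closure of `Ω`. -/
def closedConnected (Ω : Set Plane) : Set (Set Plane) :=
  {K | K ⊆ closure Ω ∧ IsClosed K ∧ IsConnected K}

/-- The set of pairs `(K, v)` with `K ∈ 𝒦`, `v ∈ L^q(Ω; ℝ²)` and, weakly,
`-div v = f` in `closure Ω ∖ K` with `v · n = 0` on `∂Ω ∖ K`, that is,
`∫_Ω v · ∇ψ = ∫_Ω ψ f` for all `ψ` of class `C¹` up to the boundary that vanish on `K`. -/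
def admissiblePairs (Ω : Set Plane) (q : ℝ) (f : Plane → ℝ) :
    Set (Set Plane × (Plane → Plane)) :=
  {P | P.1 ∈ closedConnected Ω ∧ MemLp P.2 (ENNReal.ofReal q) (volume.restrict Ω) ∧
    ∀ ψ : Plane → ℝ, ContDiff ℝ 1 ψ → (∀ x ∈ P.1, ψ x = 0) →
      ∫ x in Ω, inner ℝ (P.2 x) (gradient ψ x) = ∫ x in Ω, ψ x * f x}

/-- `Λ ℋ¹(K)`, as an extended real number. -/
def lengthPenalty (Λ : ℝ) (K : Set Plane) : EReal :=
  (Λ : EReal) * ((Measure.hausdorffMeasure 1 K : ℝ≥0∞) : EReal)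

/-- `((p-1)/p) ∫_Ω u f`, the compliance of `K` when `u = u_K`. -/
def complianceTerm (Ω : Set Plane) (p : ℝ) (f u : Plane → ℝ) : ℝ :=
  (p - 1) / p * ∫ x in Ω, u x * f x

/-- `(1/q) ∫_Ω |v|^q`. -/
def fieldTerm (Ω : Set Plane) (q : ℝ) (v : Plane → Plane) : ℝ :=
  1 / q * ∫ x in Ω, ‖v x‖ ^ q

/-- The set of values `((p-1)/p) ∫_Ω u_K f + Λ ℋ¹(K)` that are minimized in the `p`-compliance
problem, over all `K ∈ 𝒦` and all potentials `u_K` of `K`. A set `K` without a potential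
(its energy is then not bounded below) does not compete. -/
def complianceValues (Ω : Set Plane) (p Λ : ℝ) (f : Plane → ℝ) : Set EReal :=
  {c | ∃ K ∈ closedConnected Ω, ∃ u G, IsPotential Ω K p f u G ∧
    c = (complianceTerm Ω p f u : EReal) + lengthPenalty Λ K}

/-- The set of values `(1/q) ∫_Ω |v|^q + Λ ℋ¹(K)` that are minimized in the min-min problem,
over all admissible pairs `(K, v)`. -/
def fieldValues (Ω : Set Plane) (q Λ : ℝ) (f : Plane → ℝ) : Set EReal :=
  {c | ∃ P ∈ admissiblePairs Ω q f,
    c = (fieldTerm Ω q P.2 : EReal) + lengthPenalty Λ P.1}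

/-- `K` solves the `p`-compliance problem. -/
def SolvesCompliance (Ω : Set Plane) (p Λ : ℝ) (f : Plane → ℝ) (K : Set Plane) : Prop :=
  K ∈ closedConnected Ω ∧ ∃ u G, IsPotential Ω K p f u G ∧
    IsLeast (complianceValues Ω p Λ f)
      ((complianceTerm Ω p f u : EReal) + lengthPenalty Λ K)

/-- `(K, v)` solves the min-min problem. -/
def SolvesMinMin (Ω : Set Plane) (q Λ : ℝ) (f : Plane → ℝ) (K : Set Plane)
    (v : Plane → Plane) : Prop :=
  (K, v) ∈ admissiblePairs Ω q f ∧
    IsLeast (fieldValues Ω q Λ f) ((fieldTerm Ω q v : EReal) + lengthPenalty Λ K)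

end

/-!
For a fixed set `K` the two problems are convex duals of each other. If `u` minimizes
`∫ (|∇u|^p / p - u f)` over `W^{1,p}_K(Ω)`, the Euler–Lagrange equation says that the flux
`v = |∇u|^(p-2) ∇u` solves `-div v = f`, and then `∫ u f = ∫ |∇u|^p = ∫ |v|^q`; for any other
admissible field `w`, Young's inequality applied to `∫ w · ∇u = ∫ u f` gives
`(1/q) ∫ |w|^q ≥ ((p-1)/p) ∫ u f` (`IsPotential.isLeast_complianceTerm`). The statements about the
infima and the optimal sets follow by taking the infimum over `K`.

Three points need analysis on the Lipschitz domain `Ω`.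

* *The load is finite on `W^{1,p}_K(Ω)`.* This is the Sobolev inequality
  (`HasLipschitzBoundary.exists_sobolev`). It rests on the uniform interior cone property. For
  `p < 2` the estimate of `‖φ‖_{L²}` by the `W^{1,1}` norm comes from slicing along two transverse
  directions of the cone, and is applied to a power of `φ`. The case `p = 2` reduces to smaller `p`,
  and for `p > 2` the Morrey estimate is obtained by averaging over the segments from a point to a
  ball.

* *Testing with `C¹` functions vanishing on `K` is the same as testing with `W^{1,p}_K(Ω)`*
  (`mem_admissiblePairs_iff`). A `C¹` function vanishing on `K` is approximated by truncating it
  near the value `0` and mollifying; that the limit has the right gradient is the uniqueness of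
  weak gradients.

* *A potential exists as soon as there is an admissible field* (`exists_isPotential`). With an
  admissible `v` the energy reads `∫ (|∇u|^p / p - v · ∇u)`, a coercive, uniformly convex function
  of `∇u` alone, so that a minimizing sequence of gradients converges in `L^p`
  (`exists_min_energy`). The limit is again a gradient because the gradients of `W^{1,p}_K(Ω)` form
  a closed space (`HasLipschitzBoundary.isClosed_range_gradient`): by the Poincaré inequality on
  the pieces of a finite partition, a function is controlled by its gradient up to a
  finite-dimensional space of step functions. No connectedness of `Ω` and no capacity of `K`
  enters.
-/

open Filter Topology

/-! ### Smooth approximation and integration by parts -/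

theorem norm_gradient (φ : Plane → ℝ) (x : Plane) : ‖gradient φ x‖ = ‖fderiv ℝ φ x‖ := by
  simp [gradient]

theorem inner_gradient (φ : Plane → ℝ) (x w : Plane) :
    inner ℝ w (gradient φ x) = fderiv ℝ φ x w := by
  rw [real_inner_comm]
  simp [gradient]

theorem ContDiff.continuous_gradient {φ : Plane → ℝ} (hφ : ContDiff ℝ 1 φ) :
    Continuous (gradient φ) :=
  (InnerProductSpace.toDual ℝ Plane).symm.continuous.comp (hφ.continuous_fderiv one_ne_zero)

theorem HasCompactSupport.gradient {φ : Plane → ℝ} (hφ : HasCompactSupport φ) :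
    HasCompactSupport (gradient φ) :=
  hφ.fderiv (𝕜 := ℝ) |>.comp_left (g := (InnerProductSpace.toDual ℝ Plane).symm) (map_zero _)

/-- A compactly supported `C¹` function whose support avoids the closed set `K` is a limit in the
`C¹` norm of smooth functions of the same kind: its mollifications. -/
theorem exists_contDiff_approx {h : Plane → ℝ} (hh : ContDiff ℝ 1 h) (hc : HasCompactSupport h)
    {K : Set Plane} (hK : IsClosed K) (hd : Disjoint (tsupport h) K) {ε : ℝ} (hε : 0 < ε) :
    ∃ φ : Plane → ℝ, ContDiff ℝ ∞ φ ∧ HasCompactSupport φ ∧ Disjoint (tsupport φ) K ∧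
      ∀ x, ‖h x - φ x‖ ≤ ε ∧ ‖gradient h x - gradient φ x‖ ≤ ε := by
  obtain ⟨δ₀, hδ₀, hdis⟩ := hd.exists_cthickenings hc.isCompact hK
  have hcf : HasCompactSupport (fderiv ℝ h) := hc.fderiv (𝕜 := ℝ)
  have hf' : Continuous (fderiv ℝ h) := hh.continuous_fderiv one_ne_zero
  obtain ⟨δ₁, hδ₁, h1⟩ := Metric.uniformContinuous_iff.1
    (hc.uniformContinuous_of_continuous hh.continuous) ε hε
  obtain ⟨δ₂, hδ₂, h2⟩ := Metric.uniformContinuous_iff.1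
    (hcf.uniformContinuous_of_continuous hf') ε hε
  set δ := min δ₀ (min δ₁ δ₂)
  have hδ : 0 < δ := by positivity
  let b : ContDiffBump (0 : Plane) := ⟨δ / 2, δ, half_pos hδ, half_lt_self hδ⟩
  set φ : Plane → ℝ := convolution (b.normed volume) h (ContinuousLinearMap.lsmul ℝ ℝ) volume
    with hφ
  have hderiv : ∀ x, fderiv ℝ φ x =
      convolution (b.normed volume) (fderiv ℝ h) (ContinuousLinearMap.lsmul ℝ ℝ) volume x := by
    intro x
    have := (hc.hasFDerivAt_convolution_right (ContinuousLinearMap.lsmul ℝ ℝ)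
      (b.contDiff_normed (μ := volume) (n := 1)
        |>.continuous.locallyIntegrable (μ := volume)) hh x).fderiv
    rw [this]
    rfl
  -- where `h` vanishes on a ball of radius `δ`, so does its mollification at the centre
  have hsupp : tsupport φ ⊆ Metric.cthickening δ₀ (tsupport h) := by
    refine closure_minimal ?_ Metric.isClosed_cthickening
    intro x hx
    by_contra hcon
    have hz : ∀ y ∈ Metric.ball x b.rOut, h y = 0 := by
      intro y hy
      by_contra hne
      refine hcon (Metric.mem_cthickening_of_dist_le x y _ _ (subset_tsupport h hne) ?_)
      rw [dist_comm]
      exact (Metric.mem_ball.1 hy).le.trans (min_le_left _ _)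
    have hx0 : h x = 0 := hz x (Metric.mem_ball_self b.rOut_pos)
    refine hx ?_
    rw [hφ, b.normed_convolution_eq_right (fun y hy => (hz y hy).trans hx0.symm), hx0]
  refine ⟨φ, ?_, ?_, ?_, fun x => ⟨?_, ?_⟩⟩
  · exact b.hasCompactSupport_normed.contDiff_convolution_left _ b.contDiff_normed
      hh.continuous.locallyIntegrable
  · exact (hc.isCompact.cthickening).of_isClosed_subset (isClosed_tsupport _) hsupp
  · exact hdis.mono hsupp (Metric.self_subset_cthickening K)
  · rw [← dist_eq_norm, dist_comm]
    refine b.dist_normed_convolution_le hh.continuous.aestronglyMeasurable fun y hy => ?_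
    exact (h1 (lt_of_lt_of_le (Metric.mem_ball.1 hy)
      ((min_le_right _ _).trans (min_le_left _ _)))).le
  · have : gradient h x - gradient φ x
        = (InnerProductSpace.toDual ℝ Plane).symm (fderiv ℝ h x - fderiv ℝ φ x) := by
      simp [gradient]
    rw [this, LinearIsometryEquiv.norm_map, ← dist_eq_norm, dist_comm, hderiv]
    refine b.dist_normed_convolution_le hf'.aestronglyMeasurable fun y hy => ?_
    exact (h2 (lt_of_lt_of_le (Metric.mem_ball.1 hy)
      ((min_le_right _ _).trans (min_le_right _ _)))).le

/-- The classical gradient of a `C¹` function is its weak gradient. -/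
theorem ContDiff.hasWeakGradient {u : Plane → ℝ} (hu : ContDiff ℝ 1 u) (Ω : Set Plane) :
    HasWeakGradient Ω u (gradient u) := by
  intro η hη hc hs
  have hη1 : ContDiff ℝ 1 η := hη.of_le (by norm_num)
  have hz : ∀ x, x ∉ Ω → η x = 0 := fun x hx => image_eq_zero_of_notMem_tsupport
    fun h => hx (hs h)
  have hz' : ∀ x, x ∉ Ω → gradient η x = 0 := fun x hx => by
    have : fderiv ℝ η x = 0 := image_eq_zero_of_notMem_tsupport
      fun h => hx (hs (tsupport_fderiv_subset ℝ h))
    simp [gradient, this]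
  rw [setIntegral_eq_integral_of_forall_compl_eq_zero (fun x hx => by rw [hz' x hx, smul_zero]),
    setIntegral_eq_integral_of_forall_compl_eq_zero (fun x hx => by rw [hz x hx, zero_smul])]
  have i1 : Integrable (fun x => u x • gradient η x) :=
    (hu.continuous.smul hη1.continuous_gradient).integrable_of_hasCompactSupport
      hc.gradient.smul_left
  have i2 : Integrable (fun x => η x • gradient u x) :=
    (hη.continuous.smul hu.continuous_gradient).integrable_of_hasCompactSupport
      hc.smul_right
  refine ext_inner_left ℝ fun w => ?_
  rw [inner_neg_right, ← integral_inner i1, ← integral_inner i2]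
  simp_rw [inner_smul_right, inner_gradient]
  rw [integral_mul_fderiv_eq_neg_fderiv_mul_of_integrable]
  · simp_rw [mul_comm]
  · have := i2.const_inner (𝕜 := ℝ) w
    simpa only [inner_smul_right, inner_gradient, mul_comm] using this
  · have := i1.const_inner (𝕜 := ℝ) w
    simpa only [inner_smul_right, inner_gradient, mul_comm] using this
  · exact (hu.continuous.mul hη.continuous).integrable_of_hasCompactSupport hc.mul_left
  · exact fun x _ => hu.differentiable one_ne_zero x
  · exact fun x _ => hη1.differentiable one_ne_zero x

/-! ### The graph of the gradient on functions vanishing on a set -/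

/-- The classes in `L^p × L^p` of the pairs `(φ, ∇φ)` restricted to `Ω`, for `φ` smooth with compact
support disjoint from `K`. -/
noncomputable def testGraph (Ω K : Set Plane) (p : ℝ) :
    Submodule ℝ (Lp ℝ (ENNReal.ofReal p) (volume.restrict Ω) ×
      Lp Plane (ENNReal.ofReal p) (volume.restrict Ω)) where
  carrier := {z | ∃ φ : Plane → ℝ, ContDiff ℝ ∞ φ ∧ HasCompactSupport φ ∧ Disjoint (tsupport φ) K ∧
    z.1 =ᵐ[volume.restrict Ω] φ ∧ z.2 =ᵐ[volume.restrict Ω] gradient φ}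
  zero_mem' := by
    refine ⟨0, contDiff_const, HasCompactSupport.zero, by simp [tsupport], Lp.coeFn_zero _ _ _, ?_⟩
    refine (Lp.coeFn_zero _ _ _).trans (Eventually.of_forall fun x => ?_)
    simp [gradient, Pi.zero_def]
  add_mem' := by
    rintro z w ⟨φ, h1, h2, h3, h4, h5⟩ ⟨ψ, k1, k2, k3, k4, k5⟩
    refine ⟨φ + ψ, h1.add k1, h2.add k2, ?_, ?_, ?_⟩
    · exact (Disjoint.sup_left h3 k3).mono_left (tsupport_add φ ψ)
    · exact (Lp.coeFn_add _ _).trans (h4.add k4)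
    · refine (Lp.coeFn_add _ _).trans ((h5.add k5).trans (Eventually.of_forall fun x => ?_))
      simp only [gradient, Pi.add_apply]
      rw [fderiv_add (h1.differentiable (by simp) x) (k1.differentiable (by simp) x), map_add]
  smul_mem' := by
    rintro c z ⟨φ, h1, h2, h3, h4, h5⟩
    refine ⟨c • φ, contDiff_const.smul h1, h2.smul_left (f := fun _ => c), ?_, ?_, ?_⟩
    · exact h3.mono_left (tsupport_smul_subset_right (fun _ => c) φ)
    · exact (Lp.coeFn_smul _ _).trans (h4.const_smul c)
    · refine (Lp.coeFn_smul _ _).trans ((h5.const_smul c).trans (Eventually.of_forall fun x => ?_))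
      simp only [gradient, Pi.smul_apply]
      rw [fderiv_const_smul (h1.differentiable (by simp) x), map_smul]

/-- The closure of `testGraph Ω K p`: the space `W^{1,p}_K(Ω)`, each function being paired with its
weak gradient. -/
noncomputable def vanishingGraph (Ω K : Set Plane) (p : ℝ) [Fact (1 ≤ ENNReal.ofReal p)] :
    Submodule ℝ (Lp ℝ (ENNReal.ofReal p) (volume.restrict Ω) ×
      Lp Plane (ENNReal.ofReal p) (volume.restrict Ω)) :=
  (testGraph Ω K p).topologicalClosure

variable {Ω K : Set Plane} {p q : ℝ}

theorem ContDiff.memLp_restrict {φ : Plane → ℝ} (hφ : ContDiff ℝ 1 φ) (hc : HasCompactSupport φ)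
    (P : ℝ≥0∞) : MemLp φ P (volume.restrict Ω) ∧ MemLp (gradient φ) P (volume.restrict Ω) :=
  ⟨(hφ.continuous.memLp_of_hasCompactSupport hc).restrict Ω,
    (hφ.continuous_gradient.memLp_of_hasCompactSupport hc.gradient).restrict Ω⟩

theorem toLp_mem_vanishingGraph_iff [Fact (1 ≤ ENNReal.ofReal p)] {u : Plane → ℝ}
    {G : Plane → Plane} (hu : MemLp u (ENNReal.ofReal p) (volume.restrict Ω))
    (hG : MemLp G (ENNReal.ofReal p) (volume.restrict Ω)) :
    (hu.toLp u, hG.toLp G) ∈ vanishingGraph Ω K p ↔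
      ∀ ε : ℝ≥0∞, 0 < ε → ∃ φ : Plane → ℝ,
        ContDiff ℝ ∞ φ ∧ HasCompactSupport φ ∧ Disjoint (tsupport φ) K ∧
        eLpNorm (fun x => u x - φ x) (ENNReal.ofReal p) (volume.restrict Ω) < ε ∧
        eLpNorm (fun x => G x - gradient φ x) (ENNReal.ofReal p) (volume.restrict Ω) < ε := by
  rw [vanishingGraph, ← SetLike.mem_coe, Submodule.topologicalClosure_coe, EMetric.mem_closure_iff]
  refine forall₂_congr fun ε _ => ⟨?_, ?_⟩
  · rintro ⟨z, ⟨φ, h1, h2, h3, h4, h5⟩, hz⟩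
    refine ⟨φ, h1, h2, h3, ?_, ?_⟩
    · refine lt_of_le_of_lt (le_of_eq ?_) ((le_max_left _ _).trans_lt hz)
      rw [Lp.edist_def]
      exact eLpNorm_congr_ae (hu.coeFn_toLp.symm.sub h4.symm)
    · refine lt_of_le_of_lt (le_of_eq ?_) ((le_max_right _ _).trans_lt hz)
      rw [Lp.edist_def]
      exact eLpNorm_congr_ae (hG.coeFn_toLp.symm.sub h5.symm)
  · rintro ⟨φ, h1, h2, h3, h4, h5⟩
    obtain ⟨m1, m2⟩ := (h1.of_le (by norm_num) : ContDiff ℝ 1 φ).memLp_restrict (Ω := Ω) h2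
      (ENNReal.ofReal p)
    refine ⟨(m1.toLp φ, m2.toLp _), ⟨φ, h1, h2, h3, m1.coeFn_toLp, m2.coeFn_toLp⟩, ?_⟩
    rw [Prod.edist_eq, Lp.edist_toLp_toLp, Lp.edist_toLp_toLp]
    exact max_lt h4 h5

theorem HasWeakGradient.congr {u u' : Plane → ℝ} {G G' : Plane → Plane}
    (h : HasWeakGradient Ω u G) (hu : u =ᵐ[volume.restrict Ω] u')
    (hG : G =ᵐ[volume.restrict Ω] G') : HasWeakGradient Ω u' G' := by
  intro η h1 h2 h3
  rw [← integral_congr_ae (hu.mono fun x hx => by simp only [hx] :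
      (fun x => u x • gradient η x) =ᵐ[volume.restrict Ω] fun x => u' x • gradient η x),
    ← integral_congr_ae (hG.mono fun x hx => by simp only [hx] :
      (fun x => η x • G x) =ᵐ[volume.restrict Ω] fun x => η x • G' x)]
  exact h η h1 h2 h3

/-- Being a weak gradient is a closed condition, so that the elements of the closure of the smooth
pairs `(φ, ∇φ)` still consist of a function and its weak gradient. -/
theorem hasWeakGradient_of_mem_vanishingGraph [Fact (1 ≤ ENNReal.ofReal p)]
    (hpq : p.HolderConjugate q)
    {z : Lp ℝ (ENNReal.ofReal p) (volume.restrict Ω) ×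
      Lp Plane (ENNReal.ofReal p) (volume.restrict Ω)}
    (hz : z ∈ vanishingGraph Ω K p) : HasWeakGradient Ω z.1 z.2 := by
  intro η h1 h2 h3
  have := hpq.ennrealOfReal
  have := hpq.symm.ennrealOfReal
  have : Fact (1 ≤ ENNReal.ofReal q) := ⟨by simpa using hpq.symm.lt.le⟩
  obtain ⟨m1, m2⟩ := (h1.of_le (by norm_num) : ContDiff ℝ 1 η).memLp_restrict (Ω := Ω) h2
    (ENNReal.ofReal q)
  let B : ℝ →L[ℝ] Plane →L[ℝ] Plane := ContinuousLinearMap.lsmul ℝ ℝ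
  let F : Lp ℝ (ENNReal.ofReal p) (volume.restrict Ω) ×
      Lp Plane (ENNReal.ofReal p) (volume.restrict Ω) → Plane := fun z =>
    B.flip.lpPairing (volume.restrict Ω) (ENNReal.ofReal q) (ENNReal.ofReal p) (m2.toLp _) z.1 +
      B.lpPairing (volume.restrict Ω) (ENNReal.ofReal q) (ENNReal.ofReal p) (m1.toLp _) z.2
  have hF : Continuous F :=
    ((ContinuousLinearMap.continuous _).comp continuous_fst).add
      ((ContinuousLinearMap.continuous _).comp continuous_snd)
  have hFz : ∀ z, F z = (∫ x in Ω, z.1 x • gradient η x) + ∫ x in Ω, η x • z.2 x := by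
    intro z
    simp only [F, ContinuousLinearMap.lpPairing_eq_integral]
    congr 1
    · exact integral_congr_ae (m2.coeFn_toLp.mono fun x hx => by simp [hx, B])
    · exact integral_congr_ae (m1.coeFn_toLp.mono fun x hx => by simp [hx, B])
  have hsub : (vanishingGraph Ω K p : Set _) ⊆ {z | F z = 0} := by
    refine closure_minimal ?_ (isClosed_eq hF continuous_const)
    rintro z ⟨φ, k1, -, -, k4, k5⟩
    have := ((k1.of_le (by norm_num) : ContDiff ℝ 1 φ).hasWeakGradient Ω).congr k4.symm k5.symm
      η h1 h2 h3
    simp [hFz, this]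
  have := hsub hz
  rw [mem_ofPred_eq, hFz] at this
  exact eq_neg_of_add_eq_zero_left this

/-- `W^{1,p}_K(Ω)` at the level of functions is the closure of the smooth pairs at the level of
classes; the weak gradient condition comes for free. -/
theorem memW1pVanishing_iff [Fact (1 ≤ ENNReal.ofReal p)] (hpq : p.HolderConjugate q)
    {u : Plane → ℝ} {G : Plane → Plane} :
    MemW1pVanishing Ω K p u G ↔ ∃ (hu : MemLp u (ENNReal.ofReal p) (volume.restrict Ω))
      (hG : MemLp G (ENNReal.ofReal p) (volume.restrict Ω)),
      (hu.toLp u, hG.toLp G) ∈ vanishingGraph Ω K p := by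
  constructor
  · rintro ⟨⟨hu, hG, -⟩, h⟩
    exact ⟨hu, hG, (toLp_mem_vanishingGraph_iff hu hG).2 h⟩
  · rintro ⟨hu, hG, h⟩
    exact ⟨⟨hu, hG, (hasWeakGradient_of_mem_vanishingGraph hpq h).congr hu.coeFn_toLp
      hG.coeFn_toLp⟩, (toLp_mem_vanishingGraph_iff hu hG).1 h⟩

theorem memW1pVanishing_of_mem_vanishingGraph [Fact (1 ≤ ENNReal.ofReal p)]
    (hpq : p.HolderConjugate q)
    {z : Lp ℝ (ENNReal.ofReal p) (volume.restrict Ω) ×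
      Lp Plane (ENNReal.ofReal p) (volume.restrict Ω)} (hz : z ∈ vanishingGraph Ω K p) :
    MemW1pVanishing Ω K p z.1 z.2 :=
  (memW1pVanishing_iff hpq).2 ⟨Lp.memLp _, Lp.memLp _, by simpa using hz⟩

/-! ### `C¹` functions that vanish on a set -/

theorem HasWeakGradient.ae_unique (hΩ : IsOpen Ω) {u : Plane → ℝ} {G G' : Plane → Plane}
    (h : HasWeakGradient Ω u G) (h' : HasWeakGradient Ω u G')
    (hG : IntegrableOn G Ω) (hG' : IntegrableOn G' Ω) : G =ᵐ[volume.restrict Ω] G' := by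
  have key := hΩ.ae_eq_zero_of_integral_contDiff_smul_eq_zero (μ := (volume : Measure Plane))
    (f := fun x => G x - G' x) (hG.sub hG').locallyIntegrableOn ?_
  · rw [EventuallyEq, ae_restrict_iff' hΩ.measurableSet]
    exact key.mono fun x hx hxΩ => sub_eq_zero.1 (hx hxΩ)
  · intro η h1 h2 h3
    obtain ⟨C, hC⟩ := h2.exists_bound_of_continuous h1.continuous
    have i1 : Integrable (fun x => η x • G x) (volume.restrict Ω) :=
      hG.bdd_smul C h1.continuous.aestronglyMeasurable (Eventually.of_forall hC)
    have i2 : Integrable (fun x => η x • G' x) (volume.restrict Ω) :=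
      hG'.bdd_smul C h1.continuous.aestronglyMeasurable (Eventually.of_forall hC)
    rw [← setIntegral_eq_integral_of_forall_compl_eq_zero (s := Ω)]
    · simp_rw [smul_sub]
      rw [integral_sub i1 i2, sub_eq_zero, ← neg_inj, ← h η h1 h2 h3, ← h' η h1 h2 h3]
    · intro x hx
      rw [image_eq_zero_of_notMem_tsupport fun hx' => hx (h3 hx'), zero_smul]

theorem tendsto_eLpNorm_sub_of_bounded {α E : Type*} [MeasurableSpace α] [NormedAddCommGroup E]
    {μ : Measure α} [IsFiniteMeasure μ] {F : ℕ → α → E} {f : α → E} {P : ℝ≥0∞}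
    (hP0 : P ≠ 0) (hP : P ≠ ⊤) (hF : ∀ n, AEStronglyMeasurable (F n) μ)
    (hf : AEStronglyMeasurable f μ)
    (C : ℝ≥0) (hC : ∀ n x, ‖f x - F n x‖ ≤ C)
    (hlim : ∀ x, Tendsto (fun n => F n x) atTop (𝓝 (f x))) :
    Tendsto (fun n => eLpNorm (fun x => f x - F n x) P μ) atTop (𝓝 0) := by
  have hP' : 0 < P.toReal := ENNReal.toReal_pos hP0 hP
  simp_rw [eLpNorm_eq_lintegral_rpow_enorm_toReal hP0 hP]
  have : Tendsto (fun n => ∫⁻ x, ‖f x - F n x‖ₑ ^ P.toReal ∂μ) atTop (𝓝 (∫⁻ _, 0 ∂μ)) := by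
    refine tendsto_lintegral_of_dominated_convergence' (fun _ => (C : ℝ≥0∞) ^ P.toReal)
      (fun n => ((hf.sub (hF n)).enorm.pow_const _)) (fun n => Eventually.of_forall fun x => ?_)
      ?_ (Eventually.of_forall fun x => ?_)
    · refine ENNReal.rpow_le_rpow ?_ hP'.le
      rw [enorm_le_coe]
      exact_mod_cast hC n x
    · rw [lintegral_const]
      exact ENNReal.mul_ne_top (ENNReal.rpow_ne_top_of_nonneg hP'.le ENNReal.coe_ne_top)
        (measure_ne_top _ _)
    · have h1 : Tendsto (fun n => ‖f x - F n x‖ₑ) atTop (𝓝 0) := by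
        have := ((tendsto_const_nhds (x := f x)).sub (hlim x)).enorm
        simpa using this
      simpa [hP'] using h1.ennrpow_const P.toReal
  rw [lintegral_zero] at this
  simpa [hP'] using this.ennrpow_const (1 / P.toReal)

/-- The truncation `t ↦ t (1 - β (m t))`, where `β` is a smooth bump equal to `1` on `[-1, 1]`: it
vanishes for `|t| ≤ 1 / m` and is the identity for `|t| ≥ 2 / m`. Its derivative is bounded
uniformly in `m`. -/
theorem exists_truncation : ∃ (T T' : ℕ → ℝ → ℝ) (C : ℝ≥0), (∀ n, ContDiff ℝ 1 (T n)) ∧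
    (∀ n t, HasDerivAt (T n) (T' n t) t) ∧ (∀ (n : ℕ) t, |t| ≤ 1 / (n + 1 : ℝ) → T n t = 0) ∧
    (∀ n t, |t - T n t| ≤ C) ∧ (∀ n t, |T' n t| ≤ C) ∧
    (∀ t, Tendsto (fun n => T n t) atTop (𝓝 t)) ∧
    ∀ t, Tendsto (fun n => T' n t) atTop (𝓝 (if t = 0 then 0 else 1)) := by
  let b : ContDiffBump (0 : ℝ) := ⟨1, 2, one_pos, one_lt_two⟩
  have hb : ContDiff ℝ 1 b := b.contDiff
  have hb' : HasCompactSupport (fun s => s * deriv b s) := b.hasCompactSupport.deriv.mul_left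
  obtain ⟨C, hC⟩ := hb'.exists_bound_of_continuous
    (continuous_id.mul (hb.continuous_deriv le_rfl))
  have hC0 : 0 ≤ C := (norm_nonneg _).trans (hC 0)
  have hbz : ∀ s : ℝ, 2 ≤ |s| → b s = 0 := fun s hs => b.zero_of_le_dist (by simpa using hs)
  have hbz' : ∀ s : ℝ, 2 < |s| → deriv b s = 0 := by
    intro s hs
    have : b =ᶠ[𝓝 s] fun _ => (0 : ℝ) :=
      (continuous_abs.continuousAt.eventually (lt_mem_nhds hs)).mono fun t ht => hbz t ht.le
    rw [this.deriv_eq, deriv_const]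
  let m : ℕ → ℝ := fun n => n + 1
  have hm : ∀ n, 0 < m n := fun n => by positivity
  have hlarge : ∀ t : ℝ, t ≠ 0 → ∀ᶠ n in atTop, 2 < |m n * t| := by
    intro t ht
    have : Tendsto (fun n => m n * |t|) atTop atTop :=
      (tendsto_atTop_add_const_right _ _ tendsto_natCast_atTop_atTop).atTop_mul_const
        (abs_pos.2 ht)
    filter_upwards [this.eventually_gt_atTop 2] with n hn
    rwa [abs_mul, abs_of_pos (hm n)]
  refine ⟨fun n t => t * (1 - b (m n * t)),
    fun n t => 1 - b (m n * t) - (m n * t) * deriv b (m n * t), ⟨2 + C, by positivity⟩,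
    fun n => by fun_prop, fun n t => ?_, fun n t ht => ?_, fun n t => ?_, fun n t => ?_,
    fun t => ?_, fun t => ?_⟩
  · have h1 : HasDerivAt (fun t => b (m n * t)) (deriv b (m n * t) * (m n * 1)) t :=
      HasDerivAt.comp (h := fun t => m n * t) (h₂ := b) t
        ((hb.differentiable one_ne_zero _).hasDerivAt) ((hasDerivAt_id t).const_mul (m n))
    refine HasDerivAt.congr_deriv ((hasDerivAt_id' t).mul (h1.const_sub 1)) ?_
    simp only
    ring
  · have : b (m n * t) = 1 := b.one_of_mem_closedBall (by
      rw [mem_closedBall_zero_iff, Real.norm_eq_abs, abs_mul, abs_of_pos (hm n)]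
      rw [le_div_iff₀ (hm n), mul_comm] at ht
      exact ht)
    simp [this]
  · have e : t - t * (1 - b (m n * t)) = t * b (m n * t) := by ring
    change |t - t * (1 - b (m n * t))| ≤ 2 + C
    rw [e, abs_mul, abs_of_nonneg b.nonneg]
    rcases le_or_gt 2 |m n * t| with h | h
    · rw [hbz _ h]; simp; positivity
    · have h1 : |t| ≤ |m n * t| := by
        rw [abs_mul, abs_of_pos (hm n)]
        exact le_mul_of_one_le_left (abs_nonneg _) (by simp [m])
      have h2 : b (m n * t) ≤ 1 := b.le_one
      nlinarith [abs_nonneg t, b.nonneg (x := m n * t)]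
  · change |1 - b (m n * t) - (m n * t) * deriv b (m n * t)| ≤ 2 + C
    have h1 := hC (m n * t)
    rw [Real.norm_eq_abs] at h1
    have h2 : b (m n * t) ≤ 1 := b.le_one
    have h3 := b.nonneg (x := m n * t)
    rw [abs_le] at h1 ⊢
    constructor <;> linarith
  · rcases eq_or_ne t 0 with rfl | ht
    · simp
    · refine tendsto_const_nhds.congr' ?_
      filter_upwards [hlarge t ht] with n hn
      simp [hbz _ hn.le]
  · rcases eq_or_ne t 0 with rfl | ht
    · have : b 0 = 1 := b.one_of_mem_closedBall (by simp [b])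
      simp [this]
    · rw [if_neg ht]
      refine tendsto_const_nhds.congr' ?_
      filter_upwards [hlarge t ht] with n hn
      simp [hbz _ hn.le, hbz' _ hn]

theorem MemW1pVanishing.congr (hpq : p.HolderConjugate q) {u u' : Plane → ℝ} {G G' : Plane → Plane}
    (h : MemW1pVanishing Ω K p u G) (hu : u =ᵐ[volume.restrict Ω] u')
    (hG : G =ᵐ[volume.restrict Ω] G') : MemW1pVanishing Ω K p u' G' := by
  have : Fact (1 ≤ ENNReal.ofReal p) := ⟨by simpa using hpq.lt.le⟩
  obtain ⟨h1, h2, h3⟩ := (memW1pVanishing_iff hpq).1 h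
  refine (memW1pVanishing_iff hpq).2 ⟨(memLp_congr_ae hu).1 h1, (memLp_congr_ae hG).1 h2, ?_⟩
  rwa [← MemLp.toLp_congr h1 _ hu, ← MemLp.toLp_congr h2 _ hG]

theorem eLpNorm_lt_of_norm_le {α E : Type*} [MeasurableSpace α] [NormedAddCommGroup E]
    (μ : Measure α) [IsFiniteMeasure μ] (P : ℝ≥0∞) {ε : ℝ≥0∞} (hε : 0 < ε) :
    ∃ δ : ℝ, 0 < δ ∧ ∀ f : α → E, (∀ x, ‖f x‖ ≤ δ) → eLpNorm f P μ < ε := by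
  have hM : μ univ ^ P.toReal⁻¹ ≠ ⊤ :=
    ENNReal.rpow_ne_top_of_nonneg (by positivity) (measure_ne_top _ _)
  have : Tendsto (fun δ : ℝ => μ univ ^ P.toReal⁻¹ * ENNReal.ofReal δ) (𝓝[>] 0) (𝓝 0) := by
    have h1 : Tendsto (fun δ : ℝ => ENNReal.ofReal δ) (𝓝[>] 0) (𝓝 0) := by
      simpa using (ENNReal.continuous_ofReal.tendsto 0).mono_left nhdsWithin_le_nhds
    simpa using ENNReal.Tendsto.const_mul h1 (Or.inr hM)
  obtain ⟨δ, hδ, hδ'⟩ := ((this.eventually (gt_mem_nhds hε)).and self_mem_nhdsWithin).exists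
  exact ⟨δ, hδ', fun f hf => (eLpNorm_le_of_ae_bound (Eventually.of_forall hf)).trans_lt hδ⟩

/-- A compactly supported `C¹` function `h` that vanishes on `K` belongs to `W^{1,p}_K(Ω)`. The
truncations of `h` near the value `0` converge to `h`, with gradients converging to `∇h` on
`{h ≠ 0}` and to `0` on `{h = 0}`; by uniqueness of the weak gradient the limit is `∇h`. -/
theorem memW1pVanishing_of_hasCompactSupport (hΩ : IsOpen Ω) (hb : Bornology.IsBounded Ω)
    (hK : IsClosed K) (hpq : p.HolderConjugate q) {h : Plane → ℝ} (hh : ContDiff ℝ 1 h)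
    (hc : HasCompactSupport h) (hv : ∀ x ∈ K, h x = 0) :
    MemW1pVanishing Ω K p h (gradient h) := by
  have : Fact (1 ≤ ENNReal.ofReal p) := ⟨by simpa using hpq.lt.le⟩
  have : IsFiniteMeasure (volume.restrict Ω) := ⟨by
    rw [Measure.restrict_apply_univ]; exact hb.measure_lt_top⟩
  have hP0 : ENNReal.ofReal p ≠ 0 := by simpa using hpq.pos
  obtain ⟨T, T', C, hT1, hT2, hT3, hT4, hT5, hT6, hT7⟩ := exists_truncation
  obtain ⟨M, hM⟩ := hc.gradient.exists_bound_of_continuous hh.continuous_gradient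
  have hM0 : 0 ≤ M := (norm_nonneg _).trans (hM 0)
  let H : ℕ → Plane → ℝ := fun n x => T n (h x)
  have hT0 : ∀ n, T n 0 = 0 := fun n => hT3 n 0 (by simp; positivity)
  have hH1 : ∀ n, ContDiff ℝ 1 (H n) := fun n => (hT1 n).comp hh
  have hHc : ∀ n, HasCompactSupport (H n) := fun n => hc.comp_left (hT0 n)
  have hHg : ∀ n x, gradient (H n) x = T' n (h x) • gradient h x := by
    intro n x
    have := ((hT2 n (h x)).comp_hasFDerivAt x (hh.differentiable one_ne_zero x).hasFDerivAt).fderiv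
    simp only [gradient]
    rw [← map_smul]
    exact congrArg _ this
  have hHd : ∀ n, Disjoint (tsupport (H n)) K := by
    intro n
    have hsub : tsupport (H n) ⊆ {x | 1 / (n + 1 : ℝ) ≤ |h x|} := by
      refine closure_minimal (fun x hx => ?_) (isClosed_le continuous_const hh.continuous.abs)
      by_contra hcon
      exact hx (hT3 n _ (not_le.1 hcon).le)
    refine Set.disjoint_left.2 fun x hx hxK => ?_
    have := hsub hx
    rw [mem_ofPred_eq, hv x hxK, abs_zero] at this
    exact absurd this (not_le.2 (by positivity))
  let G : Plane → Plane := fun x => (if h x = 0 then (0 : ℝ) else 1) • gradient h x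
  have hGm : AEStronglyMeasurable G (volume.restrict Ω) := by
    have hi : Measurable fun x => if h x = 0 then (0 : ℝ) else 1 := ?_
    · exact hi.aestronglyMeasurable.smul
        (hh.continuous_gradient.aestronglyMeasurable (μ := volume.restrict Ω))
    exact Measurable.ite (hh.continuous.measurable (measurableSet_singleton 0))
      measurable_const measurable_const
  have l1 := tendsto_eLpNorm_sub_of_bounded (μ := volume.restrict Ω) hP0
    ENNReal.ofReal_ne_top (F := H) (f := h)
    (fun n => (hH1 n).continuous.aestronglyMeasurable) hh.continuous.aestronglyMeasurable C
    (fun n x => hT4 n _) (fun x => hT6 _)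
  have l2 := tendsto_eLpNorm_sub_of_bounded (μ := volume.restrict Ω) hP0
    ENNReal.ofReal_ne_top (F := fun n => gradient (H n)) (f := G)
    (fun n => (hH1 n).continuous_gradient.aestronglyMeasurable) hGm (⟨(1 + C) * M, by positivity⟩)
    (fun n x => by
      change ‖(if h x = 0 then (0 : ℝ) else 1) • gradient h x - gradient (H n) x‖ ≤ (1 + C) * M
      rw [hHg, ← sub_smul, norm_smul]
      refine mul_le_mul ?_ (hM x) (norm_nonneg _) (by positivity)
      refine (norm_sub_le _ _).trans (add_le_add ?_ (hT5 _ _))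
      split_ifs <;> simp)
    (fun x => by
      simp_rw [hHg]
      exact (hT7 (h x)).smul_const _)
  have mh := hh.memLp_restrict (Ω := Ω) hc (ENNReal.ofReal p)
  have mG : MemLp G (ENNReal.ofReal p) (volume.restrict Ω) := by
    refine mh.2.mono hGm (Eventually.of_forall fun x => ?_)
    simp only [G]
    split_ifs <;> simp
  have key : MemW1pVanishing Ω K p h G := by
    refine (memW1pVanishing_iff hpq).2 ⟨mh.1, mG, ?_⟩
    rw [toLp_mem_vanishingGraph_iff]
    intro ε hε
    have hε2 : 0 < ε / 2 := ENNReal.half_pos hε.ne'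
    obtain ⟨n, hn1, hn2⟩ :=
      ((l1.eventually (gt_mem_nhds hε2)).and (l2.eventually (gt_mem_nhds hε2))).exists
    obtain ⟨δ₁, hδ₁, e1⟩ := eLpNorm_lt_of_norm_le (E := ℝ) (volume.restrict Ω)
      (ENNReal.ofReal p) hε2
    obtain ⟨δ₂, hδ₂, e2⟩ := eLpNorm_lt_of_norm_le (E := Plane) (volume.restrict Ω)
      (ENNReal.ofReal p) hε2
    obtain ⟨φ, h1, h2, h3, h4⟩ := exists_contDiff_approx (hH1 n) (hHc n) hK (hHd n)
      (lt_min hδ₁ hδ₂)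
    have hφ1 : ContDiff ℝ 1 φ := h1.of_le (by norm_num)
    refine ⟨φ, h1, h2, h3, ?_, ?_⟩
    · have : (fun x => h x - φ x) = (fun x => h x - H n x) + fun x => H n x - φ x := by
        ext x; simp
      rw [this]
      have c0 := hh.continuous.aestronglyMeasurable (μ := volume.restrict Ω)
      have c1 := (hH1 n).continuous.aestronglyMeasurable (μ := volume.restrict Ω)
      have c2 := hφ1.continuous.aestronglyMeasurable (μ := volume.restrict Ω)
      refine (eLpNorm_add_le (c0.sub c1) (c1.sub c2) Fact.out).trans_lt ?_
      rw [← ENNReal.add_halves ε]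
      exact ENNReal.add_lt_add hn1 (e1 _ fun x => ((h4 x).1).trans (min_le_left _ _))
    · have : (fun x => G x - gradient φ x)
          = (fun x => G x - gradient (H n) x) + fun x => gradient (H n) x - gradient φ x := by
        ext x; simp
      have c1 := (hH1 n).continuous_gradient.aestronglyMeasurable (μ := volume.restrict Ω)
      have c2 := hφ1.continuous_gradient.aestronglyMeasurable (μ := volume.restrict Ω)
      rw [this]
      refine (eLpNorm_add_le (hGm.sub c1) (c1.sub c2) Fact.out).trans_lt ?_
      rw [← ENNReal.add_halves ε]
      exact ENNReal.add_lt_add hn2 (e2 _ fun x => ((h4 x).2).trans (min_le_right _ _))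
  refine key.congr hpq (ae_eq_refl _) ?_
  exact key.1.2.2.ae_unique hΩ (hh.hasWeakGradient Ω) (mG.integrable Fact.out)
    (mh.2.integrable Fact.out)

/-- The support of `ψ` is made compact by a cutoff equal to `1` on the bounded set `Ω`. -/
theorem memW1pVanishing_of_contDiff (hΩ : IsOpen Ω) (hb : Bornology.IsBounded Ω)
    (hK : IsClosed K) (hpq : p.HolderConjugate q) {ψ : Plane → ℝ} (hψ : ContDiff ℝ 1 ψ)
    (hv : ∀ x ∈ K, ψ x = 0) :
    MemW1pVanishing Ω K p ψ (gradient ψ) := by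
  obtain ⟨R, hR, hsub⟩ := hb.subset_ball_lt 0 0
  let b : ContDiffBump (0 : Plane) := ⟨R, R + 1, hR, by linarith⟩
  have heq : ∀ x ∈ Ω, (fun x => b x * ψ x) =ᶠ[𝓝 x] ψ := by
    intro x hx
    filter_upwards [hΩ.mem_nhds hx] with y hy
    rw [b.one_of_mem_closedBall (Metric.ball_subset_closedBall (hsub hy)), one_mul]
  have h := memW1pVanishing_of_hasCompactSupport (h := fun x => b x * ψ x) hΩ hb hK hpq
    (b.contDiff.mul hψ) b.hasCompactSupport.mul_right (fun x hx => by rw [hv x hx, mul_zero])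
  refine h.congr hpq ?_ ?_
  · filter_upwards [ae_restrict_mem hΩ.measurableSet] with x hx using (heq x hx).self_of_nhds
  · filter_upwards [ae_restrict_mem hΩ.measurableSet] with x hx
    simp only [gradient]
    rw [(heq x hx).fderiv_eq]

/-! ### Interior cones and star-shaped pieces of a Lipschitz domain -/

/-- The linear isomorphism `(s, t) ↦ (κ (s - t), κ M (s + t))`, which sends the unit square to a
parallelogram around the vertical half-axis, inside the cone of slope `M`. -/
noncomputable def coneEquiv (κ M : ℝ) (hκ : 0 < κ) (hM : 0 < M) : (ℝ × ℝ) ≃L[ℝ] Plane :=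
  LinearEquiv.toContinuousLinearEquiv
    { toFun := fun z => !₂[κ * (z.1 - z.2), κ * M * (z.1 + z.2)]
      invFun := fun y => ((y 0 / κ + y 1 / (κ * M)) / 2, (y 1 / (κ * M) - y 0 / κ) / 2)
      map_add' := fun z w => by ext i; fin_cases i <;> simp <;> ring
      map_smul' := fun c z => by ext i; fin_cases i <;> simp <;> ring
      left_inv := fun z => by
        ext <;> simp <;> field_simp <;> ring
      right_inv := fun y => by
        ext i; fin_cases i <;> simp <;> field_simp <;> ring }

theorem coneEquiv_apply_zero {κ M : ℝ} (hκ : 0 < κ) (hM : 0 < M) (z : ℝ × ℝ) :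
    coneEquiv κ M hκ hM z 0 = κ * (z.1 - z.2) := rfl

theorem coneEquiv_apply_one {κ M : ℝ} (hκ : 0 < κ) (hM : 0 < M) (z : ℝ × ℝ) :
    coneEquiv κ M hκ hM z 1 = κ * M * (z.1 + z.2) := rfl

theorem norm_coneEquiv_le {κ M : ℝ} (hκ : 0 < κ) (hM : 0 < M) {s t : ℝ} (hs : s ∈ Icc (0 : ℝ) 1)
    (ht : t ∈ Icc (0 : ℝ) 1) : ‖coneEquiv κ M hκ hM (s, t)‖ ≤ κ * (1 + 2 * M) := by
  rw [EuclideanSpace.norm_eq, Fin.sum_univ_two, coneEquiv_apply_zero, coneEquiv_apply_one]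
  refine Real.sqrt_le_iff.2 ⟨by positivity, ?_⟩
  simp only [Real.norm_eq_abs, sq_abs]
  have h1 : (κ * (s - t)) ^ 2 ≤ κ ^ 2 * 1 := by
    rw [mul_pow]
    exact mul_le_mul_of_nonneg_left (by nlinarith [hs.1, hs.2, ht.1, ht.2]) (sq_nonneg _)
  have h2 : (κ * M * (s + t)) ^ 2 ≤ (κ * M) ^ 2 * 4 := by
    rw [mul_pow (κ * M)]
    exact mul_le_mul_of_nonneg_left (by nlinarith [hs.1, hs.2, ht.1, ht.2]) (sq_nonneg _)
  have h3 : 0 ≤ κ ^ 2 * M := by positivity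
  nlinarith

/-- The uniform interior cone property, with parallelograms in place of cones. -/
theorem HasLipschitzBoundary.exists_parallelogram (hΩ : IsOpen Ω) (hL : HasLipschitzBoundary Ω)
    {x₀ : Plane} (hx₀ : x₀ ∈ closure Ω) :
    ∃ (ρ : ℝ) (L : (ℝ × ℝ) ≃L[ℝ] Plane), 0 < ρ ∧ ∀ x ∈ Ω ∩ Metric.ball x₀ ρ,
      ∀ s ∈ Icc (0 : ℝ) 1, ∀ t ∈ Icc (0 : ℝ) 1, x + L (s, t) ∈ Ω := by
  by_cases hx : x₀ ∈ Ω
  · obtain ⟨r, hr, hsub⟩ := Metric.isOpen_iff.1 hΩ x₀ hx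
    have hκ : 0 < r / 2 / 4 := by positivity
    refine ⟨r / 2, coneEquiv (r / 2 / 4) 1 hκ one_pos, by positivity, fun x hx s hs t ht => ?_⟩
    refine hsub ?_
    have h1 := norm_coneEquiv_le hκ one_pos hs ht
    have h2 := mem_ball_iff_norm.1 hx.2
    rw [mem_ball_iff_norm, add_sub_right_comm]
    refine (norm_add_le _ _).trans_lt ?_
    linarith
  · have hfr : x₀ ∈ frontier Ω := ⟨hx₀, by rwa [hΩ.interior_eq]⟩
    obtain ⟨e, g, Lg, r, hr, hg, hiff⟩ := hL x₀ hfr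
    have hM : 0 < (Lg : ℝ) + 1 := by positivity
    -- the slope `Lg + 1` keeps the parallelogram above the graph, and `κ` makes its size `r / 2`
    have hκ : 0 < r / (2 * (1 + 2 * ((Lg : ℝ) + 1))) := by positivity
    set κ := r / (2 * (1 + 2 * ((Lg : ℝ) + 1))) with hκdef
    refine ⟨r / 2, (coneEquiv κ (Lg + 1) hκ hM).trans e.symm.toContinuousLinearEquiv,
      by positivity, fun x hx s hs t ht => ?_⟩
    set w := coneEquiv κ (Lg + 1) hκ hM (s, t)
    have hval : ((coneEquiv κ (Lg + 1) hκ hM).trans e.symm.toContinuousLinearEquiv) (s, t)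
        = e.symm w := rfl
    have h1 : ‖w‖ ≤ κ * (1 + 2 * (Lg + 1)) := norm_coneEquiv_le hκ hM hs ht
    have h2 : κ * (1 + 2 * ((Lg : ℝ) + 1)) = r / 2 := by rw [hκdef]; field_simp
    have h3 := mem_ball_iff_norm.1 hx.2
    have hxr : x ∈ Metric.ball x₀ r := Metric.ball_subset_ball (by linarith) hx.2
    have hin : x + e.symm w ∈ Metric.ball x₀ r := by
      rw [mem_ball_iff_norm, add_sub_right_comm]
      refine (norm_add_le _ _).trans_lt ?_
      rw [e.symm.norm_map]
      linarith
    have hx1 := (hiff x hxr).1 hx.1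
    rw [hval, hiff _ hin, map_add, e.apply_symm_apply]
    have hlip := hg.dist_le_mul (e x 0 + w 0) (e x 0)
    simp only [Real.dist_eq, add_sub_cancel_left] at hlip
    have hw0 : w 0 = κ * (s - t) := coneEquiv_apply_zero hκ hM _
    have hw1 : w 1 = κ * (Lg + 1) * (s + t) := coneEquiv_apply_one hκ hM _
    have h4 : |w 0| ≤ κ * (s + t) := by
      rw [hw0, abs_mul, abs_of_pos hκ]
      refine mul_le_mul_of_nonneg_left ?_ hκ.le
      rw [abs_le]
      constructor <;> linarith [hs.1, ht.1]
    have h5 : (Lg : ℝ) * |w 0| ≤ Lg * (κ * (s + t)) := mul_le_mul_of_nonneg_left h4 Lg.2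
    have h6 : 0 ≤ κ * (s + t) := mul_nonneg hκ.le (add_nonneg hs.1 ht.1)
    simp only [PiLp.add_apply]
    have h7 := (abs_le.1 hlip).2
    rw [hw1]
    nlinarith

/-- Near each point of its closure, a Lipschitz domain is star-shaped with respect to a ball. -/
theorem exists_star_of_parallelogram {x₀ : Plane} {ρ : ℝ} (hρ : 0 < ρ) (L : (ℝ × ℝ) ≃L[ℝ] Plane)
    (h : ∀ x ∈ Ω ∩ Metric.ball x₀ ρ, ∀ s ∈ Icc (0 : ℝ) 1, ∀ t ∈ Icc (0 : ℝ) 1, x + L (s, t) ∈ Ω) :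
    ∃ (η : ℝ) (z₀ : Plane), 0 < η ∧ η ≤ ρ ∧ ∀ x ∈ Ω ∩ Metric.ball x₀ η, ∀ z ∈ Metric.ball z₀ η,
      ∀ t ∈ Icc (0 : ℝ) 1, x + t • (z - x) ∈ Ω := by
  have hc : ContinuousAt L.symm 0 := L.symm.continuous.continuousAt
  obtain ⟨ε, hε, hball⟩ := Metric.continuousAt_iff.1 hc (1 / 2) (by norm_num)
  refine ⟨min ρ (ε / 2), x₀ + L (1 / 2, 1 / 2), by positivity, min_le_left _ _,
    fun x hx z hz t ht => ?_⟩
  have hx1 := mem_ball_iff_norm.1 (Metric.ball_subset_ball (min_le_right ρ (ε / 2)) hx.2)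
  have hz1 := mem_ball_iff_norm.1 (Metric.ball_subset_ball (min_le_right ρ (ε / 2)) hz)
  have hd := @hball (z - x - L (1 / 2, 1 / 2)) (by
    rw [dist_zero_right]
    have : z - x - L (1 / 2, 1 / 2) = (z - (x₀ + L (1 / 2, 1 / 2))) - (x - x₀) := by abel
    rw [this]
    exact (norm_sub_le _ _).trans_lt (by linarith))
  rw [map_zero, dist_zero_right, map_sub, L.symm_apply_apply] at hd
  set y := L.symm (z - x)
  have hyz : z - x = L y := (L.apply_symm_apply _).symm
  rw [Prod.norm_def, max_lt_iff] at hd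
  simp only [Prod.fst_sub, Prod.snd_sub, Real.norm_eq_abs, abs_lt] at hd
  rw [hyz, ← map_smul]
  refine h x ⟨hx.1, Metric.ball_subset_ball (min_le_left _ _) hx.2⟩ (t * y.1) ?_ (t * y.2) ?_
  · exact ⟨mul_nonneg ht.1 (by linarith), by nlinarith [ht.1, ht.2]⟩
  · exact ⟨mul_nonneg ht.1 (by linarith), by nlinarith [ht.1, ht.2]⟩

/-! ### Poincaré and Morrey inequalities on star-shaped pieces -/

theorem lintegral_comp_smul_add {c : ℝ} (hc : c ≠ 0) (w : Plane) {h : Plane → ℝ≥0∞}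
    (hh : Measurable h) :
    ∫⁻ x, h (c • x + w) = ENNReal.ofReal ((c ^ 2)⁻¹) * ∫⁻ x, h x := by
  have h1 : ∫⁻ x, h (c • x + w) = ∫⁻ y, h (y + w) ∂(Measure.map (c • ·) volume) :=
    (lintegral_map (hh.comp (measurable_add_const w)) (measurable_const_smul c)).symm
  rw [h1, Measure.map_addHaar_smul volume hc, lintegral_smul_measure,
    lintegral_add_right_eq_self (fun y => h y) w]
  simp

/-- Jensen's inequality for `t ↦ t ^ p`. -/
theorem rpow_lintegral_le {α : Type*} [MeasurableSpace α] {ν : Measure α} [IsProbabilityMeasure ν]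
    (hpq : p.HolderConjugate q) {f : α → ℝ≥0∞} (hf : AEMeasurable f ν) :
    (∫⁻ x, f x ∂ν) ^ p ≤ ∫⁻ x, f x ^ p ∂ν := by
  have h := ENNReal.lintegral_mul_le_Lp_mul_Lq ν hpq hf (aemeasurable_const (b := (1 : ℝ≥0∞)))
  simp only [Pi.mul_apply, mul_one, ENNReal.one_rpow, lintegral_one, measure_univ] at h
  calc (∫⁻ x, f x ∂ν) ^ p ≤ ((∫⁻ x, f x ^ p ∂ν) ^ (1 / p)) ^ p :=
        ENNReal.rpow_le_rpow h hpq.nonneg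
    _ = _ := by rw [← ENNReal.rpow_mul, one_div_mul_cancel hpq.ne_zero, ENNReal.rpow_one]

theorem enorm_sub_integral_le {ν : Measure Plane} [IsProbabilityMeasure ν] {φ : Plane → ℝ}
    (hφ : Integrable φ ν) (c : ℝ) :
    ‖c - ∫ z, φ z ∂ν‖ₑ ≤ ∫⁻ z, ‖c - φ z‖ₑ ∂ν := by
  have : c - ∫ z, φ z ∂ν = ∫ z, (c - φ z) ∂ν := by
    rw [integral_sub (integrable_const c) hφ]; simp
  rw [this]
  exact enorm_integral_le_lintegral_enorm _

/-- The normalized restriction of the Lebesgue measure to `B`. -/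
noncomputable abbrev uniformOn (B : Set Plane) : Measure Plane :=
  (volume B)⁻¹ • volume.restrict B

theorem isProbabilityMeasure_uniformOn {B : Set Plane} (h0 : volume B ≠ 0) (h1 : volume B ≠ ⊤) :
    IsProbabilityMeasure (uniformOn B) :=
  ⟨by simp [ENNReal.inv_mul_cancel h0 h1]⟩

/-- The fundamental theorem of calculus along a segment contained in `Ω`. -/
theorem enorm_sub_le_of_segment {φ : Plane → ℝ} (hφ : ContDiff ℝ 1 φ) {x z : Plane} {D : ℝ≥0}
    (hD : ‖z - x‖ₑ ≤ D) (hseg : ∀ t ∈ Icc (0 : ℝ) 1, x + t • (z - x) ∈ Ω) :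
    ‖φ x - φ z‖ₑ ≤ D * ∫⁻ t in Ioc (0 : ℝ) 1,
      Ω.indicator (fun y => ‖gradient φ y‖ₑ) (x + t • (z - x)) := by
  have hder : ∀ t ∈ uIcc (0 : ℝ) 1,
      HasDerivAt (fun t : ℝ => φ (x + t • (z - x))) (fderiv ℝ φ (x + t • (z - x)) (z - x)) t := by
    intro t _
    have h1 : HasDerivAt (fun t : ℝ => x + t • (z - x)) (z - x) t := by
      simpa using ((hasDerivAt_id t).smul_const (z - x)).const_add x
    exact (hφ.differentiable one_ne_zero _).hasFDerivAt.comp_hasDerivAt t h1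
  have hcont : Continuous fun t : ℝ => fderiv ℝ φ (x + t • (z - x)) (z - x) :=
    ((hφ.continuous_fderiv one_ne_zero).comp (by fun_prop)).clm_apply continuous_const
  have hftc := intervalIntegral.integral_eq_sub_of_hasDerivAt hder (hcont.intervalIntegrable 0 1)
  simp only [one_smul, zero_smul, add_zero, add_sub_cancel] at hftc
  rw [← neg_sub, enorm_neg, ← hftc, intervalIntegral.integral_of_le zero_le_one]
  refine (enorm_integral_le_lintegral_enorm _).trans ?_
  refine (setLIntegral_mono_ae' (g := fun t => D * Ω.indicator (fun y => ‖gradient φ y‖ₑ)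
    (x + t • (z - x))) measurableSet_Ioc (Eventually.of_forall fun t ht => ?_)).trans ?_
  · rw [indicator_of_mem (hseg t ⟨ht.1.le, ht.2⟩), mul_comm]
    have h2 : ‖gradient φ (x + t • (z - x))‖ₑ = ‖fderiv ℝ φ (x + t • (z - x))‖ₑ := by
      rw [← ofReal_norm, norm_gradient, ofReal_norm]
    rw [h2]
    exact (ContinuousLinearMap.le_opENorm _ _).trans (by gcongr)
  · rw [lintegral_const_mul' _ _ ENNReal.coe_ne_top]

section Star

variable {A B : Set Plane} {D : ℝ≥0}

/-- Averaging over the segments joining two sets. Substituting in the variable `x` for `t ≤ 1 / 2`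
and in the variable `z` for `t ≥ 1 / 2` keeps the Jacobian bounded. -/
theorem lintegral_lintegral_segment_le {h : Plane → ℝ≥0∞} (hh : Measurable h)
    (hB0 : volume B ≠ 0) (hB : volume B ≠ ⊤) {t : ℝ} (ht : t ∈ Ioc (0 : ℝ) 1) :
    ∫⁻ x in A, ∫⁻ z, h (x + t • (z - x)) ∂(uniformOn B) ≤
      4 * (1 + (volume B)⁻¹ * volume A) * ∫⁻ y, h y := by
  have := isProbabilityMeasure_uniformOn hB0 hB
  have hinv : ∀ c : ℝ, 1 / 2 ≤ c → ENNReal.ofReal ((c ^ 2)⁻¹) ≤ 4 := by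
    intro c hc
    rw [show (4 : ℝ≥0∞) = ENNReal.ofReal 4 by simp]
    refine ENNReal.ofReal_le_ofReal ?_
    rw [inv_le_comm₀ (by positivity) (by norm_num)]
    nlinarith
  rcases le_total t (1 / 2) with h2 | h2
  · rw [lintegral_lintegral_swap (f := fun x z => h (x + t • (z - x)))
      (hh.comp (g := h) (f := fun w : Plane × Plane => w.1 + t • (w.2 - w.1))
        (by fun_prop)).aemeasurable]
    have hle : ∀ z, ∫⁻ x in A, h (x + t • (z - x)) ≤ 4 * ∫⁻ y, h y := by
      intro z
      refine (lintegral_mono' Measure.restrict_le_self le_rfl).trans ?_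
      have : ∀ x : Plane, x + t • (z - x) = (1 - t) • x + t • z := fun x => by module
      simp_rw [this]
      rw [lintegral_comp_smul_add (by linarith) _ hh]
      gcongr
      exact hinv _ (by linarith)
    refine (lintegral_mono hle).trans ?_
    rw [lintegral_const, measure_univ, mul_one]
    gcongr
    exact le_mul_of_one_le_right (by simp) le_self_add
  · have hle : ∀ x, ∫⁻ z, h (x + t • (z - x)) ∂(uniformOn B) ≤
        (volume B)⁻¹ * (4 * ∫⁻ y, h y) := by
      intro x
      rw [lintegral_smul_measure, smul_eq_mul]
      gcongr
      refine (lintegral_mono' Measure.restrict_le_self le_rfl).trans ?_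
      have : ∀ z : Plane, x + t • (z - x) = t • z + (1 - t) • x := fun z => by module
      simp_rw [this]
      rw [lintegral_comp_smul_add ht.1.ne' _ hh]
      gcongr
      exact hinv _ h2
    refine (lintegral_mono hle).trans ?_
    rw [lintegral_const, Measure.restrict_apply_univ]
    calc (volume B)⁻¹ * (4 * ∫⁻ y, h y) * volume A
        = 4 * ((volume B)⁻¹ * volume A) * ∫⁻ y, h y := by ring
      _ ≤ _ := by gcongr; exact le_add_self

theorem ContDiff.integrable_uniformOn {φ : Plane → ℝ} (hφ : ContDiff ℝ 1 φ)
    (hBb : Bornology.IsBounded B) (hB0 : volume B ≠ 0) : Integrable φ (uniformOn B) := by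
  refine Integrable.smul_measure ?_ (ENNReal.inv_ne_top.2 hB0)
  exact (hφ.continuous.continuousOn.integrableOn_compact hBb.isCompact_closure).mono_set
    subset_closure

/-- **Poincaré inequality**: if `Ω` contains the segments between `A` and `B`, then a function is
close on `A` to its mean over `B` as soon as its gradient is small on `Ω`. -/
theorem lintegral_rpow_sub_mean_le (hΩ : MeasurableSet Ω) (hA : MeasurableSet A)
    (hBm : MeasurableSet B)
    (hpq : p.HolderConjugate q) (hBb : Bornology.IsBounded B) (hB0 : volume B ≠ 0)
    (hD : ∀ x ∈ A, ∀ z ∈ B, ‖z - x‖ₑ ≤ D)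
    (hstar : ∀ x ∈ A, ∀ z ∈ B, ∀ t ∈ Icc (0 : ℝ) 1, x + t • (z - x) ∈ Ω)
    {φ : Plane → ℝ} (hφ : ContDiff ℝ 1 φ) :
    ∫⁻ x in A, ‖φ x - ∫ z, φ z ∂(uniformOn B)‖ₑ ^ p ≤
      (D : ℝ≥0∞) ^ p * (4 * (1 + (volume B)⁻¹ * volume A)) *
        ∫⁻ y in Ω, ‖gradient φ y‖ₑ ^ p := by
  have hB : volume B ≠ ⊤ := hBb.measure_lt_top.ne
  have := isProbabilityMeasure_uniformOn hB0 hB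
  have hprob : IsProbabilityMeasure (volume.restrict (Ioc (0 : ℝ) 1)) := ⟨by simp⟩
  set g : Plane → ℝ≥0∞ := Ω.indicator (fun y => ‖gradient φ y‖ₑ) with hg
  have hgm : Measurable g := hφ.continuous_gradient.enorm.measurable.indicator hΩ
  have hgp : Measurable fun y => g y ^ p := hgm.pow_const p
  have hgint : ∫⁻ y, g y ^ p = ∫⁻ y in Ω, ‖gradient φ y‖ₑ ^ p := by
    rw [← lintegral_indicator hΩ]
    refine lintegral_congr fun y => ?_
    by_cases hy : y ∈ Ω <;> simp [hg, hy, hpq.pos]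
  have hstep : ∀ x ∈ A, ‖φ x - ∫ z, φ z ∂(uniformOn B)‖ₑ ^ p ≤
      (D : ℝ≥0∞) ^ p * ∫⁻ z, (∫⁻ t in Ioc (0 : ℝ) 1, g (x + t • (z - x)) ^ p)
        ∂(uniformOn B) := by
    intro x hx
    calc ‖φ x - ∫ z, φ z ∂(uniformOn B)‖ₑ ^ p
        ≤ (∫⁻ z, ‖φ x - φ z‖ₑ ∂(uniformOn B)) ^ p :=
          ENNReal.rpow_le_rpow (enorm_sub_integral_le (hφ.integrable_uniformOn hBb hB0) _)
            hpq.nonneg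
      _ ≤ ∫⁻ z, ‖φ x - φ z‖ₑ ^ p ∂(uniformOn B) :=
          rpow_lintegral_le hpq (continuous_const.sub hφ.continuous).enorm.measurable.aemeasurable
      _ ≤ ∫⁻ z, (D : ℝ≥0∞) ^ p * (∫⁻ t in Ioc (0 : ℝ) 1, g (x + t • (z - x)) ^ p)
            ∂(uniformOn B) := by
          refine lintegral_mono_ae (Measure.ae_smul_measure ?_ _)
          filter_upwards [ae_restrict_mem hBm] with z hz
          calc ‖φ x - φ z‖ₑ ^ p ≤ (D * ∫⁻ t in Ioc (0 : ℝ) 1, g (x + t • (z - x))) ^ p :=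
                ENNReal.rpow_le_rpow (enorm_sub_le_of_segment hφ (hD x hx z hz) (hstar x hx z hz))
                  hpq.nonneg
            _ = (D : ℝ≥0∞) ^ p * (∫⁻ t in Ioc (0 : ℝ) 1, g (x + t • (z - x))) ^ p :=
                ENNReal.mul_rpow_of_nonneg _ _ hpq.nonneg
            _ ≤ _ := by
                gcongr
                exact rpow_lintegral_le hpq (hgm.comp (by fun_prop)).aemeasurable
      _ = _ := lintegral_const_mul' _ _ (ENNReal.rpow_ne_top_of_nonneg hpq.nonneg
          ENNReal.coe_ne_top)
  have hDp : (D : ℝ≥0∞) ^ p ≠ ⊤ := ENNReal.rpow_ne_top_of_nonneg hpq.nonneg ENNReal.coe_ne_top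
  refine (setLIntegral_mono_ae' hA (Eventually.of_forall hstep)).trans ?_
  rw [lintegral_const_mul' _ _ hDp, mul_assoc]
  gcongr
  have hswap : ∀ x, ∫⁻ z, (∫⁻ t in Ioc (0 : ℝ) 1, g (x + t • (z - x)) ^ p) ∂(uniformOn B)
      = ∫⁻ t in Ioc (0 : ℝ) 1, ∫⁻ z, g (x + t • (z - x)) ^ p ∂(uniformOn B) := fun x =>
    lintegral_lintegral_swap (f := fun z t => g (x + t • (z - x)) ^ p)
      (hgp.comp (f := fun w : Plane × ℝ => x + w.2 • (w.1 - x)) (by fun_prop)).aemeasurable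
  simp_rw [hswap]
  rw [lintegral_lintegral_swap]
  · refine (setLIntegral_mono_ae' measurableSet_Ioc (Eventually.of_forall fun t ht =>
      lintegral_lintegral_segment_le hgp hB0 hB ht)).trans ?_
    rw [lintegral_const, measure_univ, mul_one, hgint]
  · refine Measurable.aemeasurable ?_
    exact Measurable.lintegral_prod_right' (f := fun w : (Plane × ℝ) × Plane =>
      g (w.1.1 + w.1.2 • (w.2 - w.1.1)) ^ p)
      (hgp.comp (f := fun w : (Plane × ℝ) × Plane => w.1.1 + w.1.2 • (w.2 - w.1.1)) (by fun_prop))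

/-- **Morrey inequality** on a star-shaped piece, for `p > 2`. -/
theorem exists_enorm_sub_mean_le (hΩ : MeasurableSet Ω) (hBm : MeasurableSet B)
    (hpq : p.HolderConjugate q) (hp : 2 < p) (hBb : Bornology.IsBounded B) (hB0 : volume B ≠ 0)
    (hD : ∀ x ∈ A, ∀ z ∈ B, ‖z - x‖ₑ ≤ D)
    (hstar : ∀ x ∈ A, ∀ z ∈ B, ∀ t ∈ Icc (0 : ℝ) 1, x + t • (z - x) ∈ Ω) :
    ∃ C : ℝ≥0∞, C ≠ ⊤ ∧ ∀ φ : Plane → ℝ, ContDiff ℝ 1 φ → ∀ x ∈ A,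
      ‖φ x - ∫ z, φ z ∂(uniformOn B)‖ₑ ≤
        C * (∫⁻ y in Ω, ‖gradient φ y‖ₑ ^ p) ^ (1 / p) := by
  have hB : volume B ≠ ⊤ := hBb.measure_lt_top.ne
  have := isProbabilityMeasure_uniformOn hB0 hB
  have hp0 : 0 < p := hpq.pos
  have hJ : ∫⁻ t in Ioc (0 : ℝ) 1, ENNReal.ofReal (t ^ (-(2 / p))) ≠ ⊤ := by
    have hi : IntervalIntegrable (fun t : ℝ => t ^ (-(2 / p))) volume 0 1 :=
      intervalIntegral.intervalIntegrable_rpow' (by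
        rw [neg_lt_neg_iff, div_lt_one hp0]; exact hp)
    rw [intervalIntegrable_iff_integrableOn_Ioc_of_le zero_le_one] at hi
    refine (lt_of_le_of_lt (lintegral_mono fun t => ?_) hi.hasFiniteIntegral).ne
    exact Real.ofReal_le_enorm _
  refine ⟨D * ((volume B)⁻¹ ^ (1 / p) * ∫⁻ t in Ioc (0 : ℝ) 1, ENNReal.ofReal (t ^ (-(2 / p)))),
    ENNReal.mul_ne_top ENNReal.coe_ne_top (ENNReal.mul_ne_top (ENNReal.rpow_ne_top_of_nonneg
      (by positivity) (ENNReal.inv_ne_top.2 hB0)) hJ), fun φ hφ x hx => ?_⟩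
  set g : Plane → ℝ≥0∞ := Ω.indicator (fun y => ‖gradient φ y‖ₑ) with hg
  have hgm : Measurable g := hφ.continuous_gradient.enorm.measurable.indicator hΩ
  have hgp : Measurable fun y => g y ^ p := hgm.pow_const p
  have hgint : ∫⁻ y, g y ^ p = ∫⁻ y in Ω, ‖gradient φ y‖ₑ ^ p := by
    rw [← lintegral_indicator hΩ]
    refine lintegral_congr fun y => ?_
    by_cases hy : y ∈ Ω <;> simp [hg, hy, hpq.pos]
  have hinner : ∀ t ∈ Ioc (0 : ℝ) 1, ∫⁻ z, g (x + t • (z - x)) ∂(uniformOn B) ≤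
      (volume B)⁻¹ ^ (1 / p) * (∫⁻ y, g y ^ p) ^ (1 / p) * ENNReal.ofReal (t ^ (-(2 / p))) := by
    intro t ht
    have h1 : (∫⁻ z, g (x + t • (z - x)) ∂(uniformOn B)) ^ p ≤
        (volume B)⁻¹ * (ENNReal.ofReal ((t ^ 2)⁻¹) * ∫⁻ y, g y ^ p) := by
      refine (rpow_lintegral_le (f := fun z => g (x + t • (z - x))) hpq
        (hgm.comp (by fun_prop)).aemeasurable).trans ?_
      rw [lintegral_smul_measure, smul_eq_mul]
      gcongr
      refine (lintegral_mono' Measure.restrict_le_self le_rfl).trans ?_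
      have : ∀ z : Plane, x + t • (z - x) = t • z + (1 - t) • x := fun z => by module
      simp_rw [this]
      rw [lintegral_comp_smul_add ht.1.ne' _ hgp]
    have h2 := ENNReal.rpow_le_rpow h1 (by positivity : 0 ≤ 1 / p)
    rw [← ENNReal.rpow_mul, mul_one_div_cancel hp0.ne', ENNReal.rpow_one,
      ENNReal.mul_rpow_of_nonneg _ _ (by positivity),
      ENNReal.mul_rpow_of_nonneg _ _ (by positivity),
      ENNReal.ofReal_rpow_of_nonneg (by positivity) (by positivity)] at h2
    have h3 : ((t ^ 2)⁻¹) ^ (1 / p) = t ^ (-(2 / p)) := by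
      rw [← Real.rpow_natCast, ← Real.rpow_neg ht.1.le, ← Real.rpow_mul ht.1.le]
      congr 1
      push_cast
      ring
    rw [h3] at h2
    refine h2.trans (le_of_eq (by ring))
  calc ‖φ x - ∫ z, φ z ∂(uniformOn B)‖ₑ
      ≤ ∫⁻ z, ‖φ x - φ z‖ₑ ∂(uniformOn B) :=
        enorm_sub_integral_le (hφ.integrable_uniformOn hBb hB0) _
    _ ≤ ∫⁻ z, D * (∫⁻ t in Ioc (0 : ℝ) 1, g (x + t • (z - x))) ∂(uniformOn B) := by
        refine lintegral_mono_ae (Measure.ae_smul_measure ?_ _)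
        filter_upwards [ae_restrict_mem hBm] with z hz
        exact enorm_sub_le_of_segment hφ (hD x hx z hz) (hstar x hx z hz)
    _ = D * ∫⁻ t in Ioc (0 : ℝ) 1, ∫⁻ z, g (x + t • (z - x)) ∂(uniformOn B) := by
        rw [lintegral_const_mul' _ _ ENNReal.coe_ne_top,
          lintegral_lintegral_swap (f := fun z t => g (x + t • (z - x)))
            (hgm.comp (f := fun w : Plane × ℝ => x + w.2 • (w.1 - x)) (by fun_prop)).aemeasurable]
    _ ≤ D * ∫⁻ t in Ioc (0 : ℝ) 1, (volume B)⁻¹ ^ (1 / p) * (∫⁻ y, g y ^ p) ^ (1 / p) *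
          ENNReal.ofReal (t ^ (-(2 / p))) := by
        refine mul_le_mul_right ?_ _
        exact setLIntegral_mono_ae' measurableSet_Ioc (Eventually.of_forall hinner)
    _ = _ := by
        rw [lintegral_const_mul _ (by fun_prop), hgint]
        ring

end Star

/-! ### Sobolev inequalities on a bounded Lipschitz domain -/

/-- A bounded Lipschitz domain is a finite union of pieces `Ω ∩ ball (c i) (η i)` from which a
parallelogram of fixed shape stays in `Ω`, and which are star-shaped with respect to a ball. -/
theorem HasLipschitzBoundary.exists_pieces (hΩ : IsOpen Ω) (hb : Bornology.IsBounded Ω)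
    (hL : HasLipschitzBoundary Ω) :
    ∃ (n : ℕ) (c z : Fin n → Plane) (η : Fin n → ℝ) (L : Fin n → (ℝ × ℝ) ≃L[ℝ] Plane),
      Ω ⊆ ⋃ i, Ω ∩ Metric.ball (c i) (η i) ∧ ∀ i, 0 < η i ∧
      (∀ x ∈ Ω ∩ Metric.ball (c i) (η i), ∀ s ∈ Icc (0 : ℝ) 1, ∀ t ∈ Icc (0 : ℝ) 1,
        x + L i (s, t) ∈ Ω) ∧
      ∀ x ∈ Ω ∩ Metric.ball (c i) (η i), ∀ y ∈ Metric.ball (z i) (η i), ∀ t ∈ Icc (0 : ℝ) 1,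
        x + t • (y - x) ∈ Ω := by
  have h : ∀ x₀ ∈ closure Ω, ∃ (η : ℝ) (z : Plane) (L : (ℝ × ℝ) ≃L[ℝ] Plane), 0 < η ∧
      (∀ x ∈ Ω ∩ Metric.ball x₀ η, ∀ s ∈ Icc (0 : ℝ) 1, ∀ t ∈ Icc (0 : ℝ) 1, x + L (s, t) ∈ Ω) ∧
      ∀ x ∈ Ω ∩ Metric.ball x₀ η, ∀ y ∈ Metric.ball z η, ∀ t ∈ Icc (0 : ℝ) 1,
        x + t • (y - x) ∈ Ω := by
    intro x₀ hx₀
    obtain ⟨ρ, L, hρ, h1⟩ := hL.exists_parallelogram hΩ hx₀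
    obtain ⟨η, z, hη, hle, h2⟩ := exists_star_of_parallelogram hρ L h1
    exact ⟨η, z, L, hη,
      fun x hx => h1 x ⟨hx.1, Metric.ball_subset_ball hle hx.2⟩, h2⟩
  choose! η z L h1 h2 h3 using h
  obtain ⟨t, ht, hcov⟩ := hb.isCompact_closure.elim_nhds_subcover (fun x => Metric.ball x (η x))
    fun x hx => Metric.ball_mem_nhds x (h1 x hx)
  let e := t.equivFin
  have hmem : ∀ i, (e.symm i : Plane) ∈ closure Ω := fun i => ht _ (e.symm i).2
  refine ⟨t.card, fun i => e.symm i, fun i => z (e.symm i), fun i => η (e.symm i),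
    fun i => L (e.symm i) (hmem i), fun x hx => ?_,
    fun i => ⟨h1 _ (hmem i), h2 _ (hmem i), h3 _ (hmem i)⟩⟩
  obtain ⟨y, hy, hxy⟩ := mem_iUnion₂.1 (hcov (subset_closure hx))
  exact mem_iUnion.2 ⟨e ⟨y, hy⟩, hx, by simpa using hxy⟩

theorem enorm_gradient (φ : Plane → ℝ) (x : Plane) : ‖gradient φ x‖ₑ = ‖fderiv ℝ φ x‖ₑ := by
  rw [← ofReal_norm, norm_gradient, ofReal_norm]

/-- One-dimensional estimate of a value by the integral over a segment, obtained by integrating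
the derivative of `s ↦ (1 - s) g (x + s d)`. -/
theorem enorm_le_lintegral_segment {g : Plane → ℝ} (hg : ContDiff ℝ 1 g) {x d : Plane}
    (hseg : ∀ s ∈ Icc (0 : ℝ) 1, x + s • d ∈ Ω) :
    ‖g x‖ₑ ≤ (1 + ‖d‖ₑ) *
      ∫⁻ s : ℝ, Ω.indicator (fun y => ‖g y‖ₑ + ‖gradient g y‖ₑ) (x + s • d) := by
  have hder : ∀ s ∈ uIcc (0 : ℝ) 1, HasDerivAt (fun s : ℝ => (1 - s) * g (x + s • d))
      (-g (x + s • d) + (1 - s) * fderiv ℝ g (x + s • d) d) s := by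
    intro s _
    have h1 : HasDerivAt (fun s : ℝ => x + s • d) d s := by
      simpa using ((hasDerivAt_id s).smul_const d).const_add x
    have h2 := (hg.differentiable one_ne_zero _).hasFDerivAt.comp_hasDerivAt s h1
    refine (((hasDerivAt_id' s).const_sub 1).mul h2).congr_deriv ?_
    simp
  have hcg : Continuous fun s : ℝ => g (x + s • d) := hg.continuous.comp (by fun_prop)
  have hcf : Continuous fun s : ℝ => fderiv ℝ g (x + s • d) d :=
    ((hg.continuous_fderiv one_ne_zero).comp (by fun_prop)).clm_apply continuous_const
  have hcont : Continuous fun s : ℝ => -g (x + s • d) + (1 - s) * fderiv ℝ g (x + s • d) d := by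
    fun_prop
  have hftc := intervalIntegral.integral_eq_sub_of_hasDerivAt hder (hcont.intervalIntegrable 0 1)
  simp only [sub_self, zero_mul, zero_sub, sub_zero, one_mul, zero_smul, add_zero] at hftc
  rw [← enorm_neg, ← hftc, intervalIntegral.integral_of_le zero_le_one]
  refine (enorm_integral_le_lintegral_enorm _).trans ?_
  have hc : (1 + ‖d‖ₑ) ≠ ⊤ := by simp
  rw [← lintegral_const_mul' _ _ hc]
  refine (setLIntegral_mono_ae' (g := fun s => (1 + ‖d‖ₑ) *
    Ω.indicator (fun y => ‖g y‖ₑ + ‖gradient g y‖ₑ) (x + s • d)) measurableSet_Ioc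
    (Eventually.of_forall fun s hs => ?_)).trans
    (lintegral_mono' Measure.restrict_le_self le_rfl)
  rw [indicator_of_mem (hseg s ⟨hs.1.le, hs.2⟩), enorm_gradient]
  have h1 : ‖(1 - s) * fderiv ℝ g (x + s • d) d‖ₑ ≤ ‖fderiv ℝ g (x + s • d)‖ₑ * ‖d‖ₑ := by
    rw [enorm_mul]
    refine (mul_le_of_le_one_left (by simp) ?_).trans (ContinuousLinearMap.le_opENorm _ _)
    rw [Real.enorm_eq_ofReal (by linarith [hs.2]), ENNReal.ofReal_le_one]
    linarith [hs.1]
  refine (enorm_add_le _ _).trans ?_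
  rw [enorm_neg]
  calc ‖g (x + s • d)‖ₑ + ‖(1 - s) * fderiv ℝ g (x + s • d) d‖ₑ
      ≤ 1 * ‖g (x + s • d)‖ₑ + ‖d‖ₑ * ‖fderiv ℝ g (x + s • d)‖ₑ := by
        rw [one_mul, mul_comm ‖d‖ₑ]; gcongr
    _ ≤ (1 + ‖d‖ₑ) * ‖g (x + s • d)‖ₑ + (1 + ‖d‖ₑ) * ‖fderiv ℝ g (x + s • d)‖ₑ := by
        gcongr
        · exact le_self_add
        · exact le_add_self
    _ = _ := by rw [mul_add]

/-- The Gagliardo–Nirenberg slicing argument along two transverse directions: `g` is bounded on `A`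
by a function of either coordinate, and the integral of the product of the two factorizes. -/
theorem exists_lintegral_sq_le_of_parallelogram {A : Set Plane} (hΩ : MeasurableSet Ω)
    (hA : MeasurableSet A) (L : (ℝ × ℝ) ≃L[ℝ] Plane)
    (h : ∀ x ∈ A, ∀ s ∈ Icc (0 : ℝ) 1, ∀ t ∈ Icc (0 : ℝ) 1, x + L (s, t) ∈ Ω) :
    ∃ C : ℝ≥0∞, C ≠ ⊤ ∧ ∀ g : Plane → ℝ, ContDiff ℝ 1 g →
      ∫⁻ x in A, ‖g x‖ₑ ^ 2 ≤ C * (∫⁻ x in Ω, (‖g x‖ₑ + ‖gradient g x‖ₑ)) ^ 2 := by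
  have hhaar : (Measure.map L volume).IsAddHaarMeasure := L.isAddHaarMeasure_map volume
  obtain ⟨c, hc0, hct, hc⟩ : ∃ c : ℝ≥0∞, c ≠ 0 ∧ c ≠ ⊤ ∧
      (volume : Measure Plane) = c • Measure.map L volume :=
    ⟨Measure.addHaarScalarFactor volume (Measure.map L volume),
      ENNReal.coe_ne_zero.2 (Measure.addHaarScalarFactor_pos_of_isAddHaarMeasure _ _).ne',
      ENNReal.coe_ne_top, Measure.isAddLeftInvariant_eq_smul _ _⟩
  set d₁ := L (1, 0) with hd₁
  set d₂ := L (0, 1) with hd₂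
  set M : ℝ≥0∞ := (1 + ‖d₁‖ₑ) * (1 + ‖d₂‖ₑ) with hM
  have hMt : M ≠ ⊤ := ENNReal.mul_ne_top (by simp) (by simp)
  have hLm : Measurable L := L.continuous.measurable
  refine ⟨c * (M * (c⁻¹) ^ 2), ENNReal.mul_ne_top hct (ENNReal.mul_ne_top hMt
    (ENNReal.pow_ne_top (ENNReal.inv_ne_top.2 hc0))), fun g hg => ?_⟩
  set H : Plane → ℝ≥0∞ := Ω.indicator (fun y => ‖g y‖ₑ + ‖gradient g y‖ₑ)
  have hHm : Measurable H :=
    (hg.continuous.enorm.measurable.add hg.continuous_gradient.enorm.measurable).indicator hΩ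
  have hHL : Measurable fun z : ℝ × ℝ => H (L z) := hHm.comp hLm
  have hint : ∀ f : Plane → ℝ≥0∞, Measurable f → ∫⁻ x, f x = c * ∫⁻ z, f (L z) := by
    intro f hf
    rw [hc, lintegral_smul_measure, lintegral_map hf hLm, smul_eq_mul]
  set U : ℝ → ℝ≥0∞ := fun b => ∫⁻ σ, H (L (σ, b)) with hU
  set V : ℝ → ℝ≥0∞ := fun a => ∫⁻ τ, H (L (a, τ)) with hV
  have hUm : Measurable U := hHL.lintegral_prod_left'
  have hVm : Measurable V := hHL.lintegral_prod_right'
  have hcoord : ∀ a b s t : ℝ, L (a, b) + L (s, t) = L (a + s, b + t) := by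
    intro a b s t
    rw [← map_add]
    rfl
  have hs1 : ∀ s : ℝ, s • d₁ = L (s, 0) := fun s => by rw [hd₁, ← map_smul]; simp
  have hs2 : ∀ s : ℝ, s • d₂ = L (0, s) := fun s => by rw [hd₂, ← map_smul]; simp
  have hzero : (0 : ℝ) ∈ Icc (0 : ℝ) 1 := ⟨le_rfl, zero_le_one⟩
  have hpt : ∀ a b : ℝ, L (a, b) ∈ A → ‖g (L (a, b))‖ₑ ^ 2 ≤ M * (V a * U b) := by
    intro a b hab
    have e1 := enorm_le_lintegral_segment hg (Ω := Ω) (x := L (a, b)) (d := d₁)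
      fun s hs => by rw [hs1]; exact h _ hab s hs 0 hzero
    have e2 := enorm_le_lintegral_segment hg (Ω := Ω) (x := L (a, b)) (d := d₂)
      fun s hs => by rw [hs2]; exact h _ hab 0 hzero s hs
    simp_rw [hs1, hcoord, add_zero] at e1
    simp_rw [hs2, hcoord, add_zero] at e2
    rw [lintegral_add_left_eq_self (fun s => H (L (s, b))) a] at e1
    rw [lintegral_add_left_eq_self (fun s => H (L (a, s))) b] at e2
    rw [sq]
    refine (mul_le_mul' e1 e2).trans (le_of_eq ?_)
    simp only [hM, hU, hV]
    ring
  calc ∫⁻ x in A, ‖g x‖ₑ ^ 2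
      = c * ∫⁻ z, A.indicator (fun x => ‖g x‖ₑ ^ 2) (L z) := by
        rw [← lintegral_indicator hA]
        exact hint _ ((hg.continuous.enorm.measurable.pow_const 2).indicator hA)
    _ ≤ c * ∫⁻ z : ℝ × ℝ, M * (V z.1 * U z.2) := by
        gcongr with z
        by_cases hz : L z ∈ A
        · rw [indicator_of_mem hz]; exact hpt z.1 z.2 hz
        · rw [indicator_of_notMem hz]; exact zero_le
    _ = c * (M * ((∫⁻ z, H (L z)) * ∫⁻ z, H (L z))) := by
        rw [lintegral_const_mul' _ _ hMt, Measure.volume_eq_prod,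
          lintegral_prod_mul hVm.aemeasurable hUm.aemeasurable]
        congr 3
        · exact (lintegral_prod _ hHL.aemeasurable).symm
        · exact (lintegral_prod_symm _ hHL.aemeasurable).symm
    _ = c * (M * (c⁻¹) ^ 2) * (∫⁻ x in Ω, (‖g x‖ₑ + ‖gradient g x‖ₑ)) ^ 2 := by
        rw [← lintegral_indicator hΩ, hint _ hHm]
        have hcc : c⁻¹ * c = 1 := ENNReal.inv_mul_cancel hc0 hct
        set I := ∫⁻ z, H (L z)
        calc c * (M * (I * I)) = c * (M * ((c⁻¹ * c) * I) * ((c⁻¹ * c) * I)) := by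
              rw [hcc, one_mul, mul_assoc M]
          _ = _ := by ring

/-- The embedding of `W^{1,1}` into `L²`. -/
theorem HasLipschitzBoundary.exists_lintegral_sq_le (hΩ : IsOpen Ω) (hb : Bornology.IsBounded Ω)
    (hL : HasLipschitzBoundary Ω) :
    ∃ C : ℝ≥0∞, C ≠ ⊤ ∧ ∀ g : Plane → ℝ, ContDiff ℝ 1 g →
      ∫⁻ x in Ω, ‖g x‖ₑ ^ 2 ≤ C * (∫⁻ x in Ω, (‖g x‖ₑ + ‖gradient g x‖ₑ)) ^ 2 := by
  obtain ⟨n, c, z, η, L, hcov, hp⟩ := hL.exists_pieces hΩ hb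
  have hA : ∀ i, MeasurableSet (Ω ∩ Metric.ball (c i) (η i)) := fun i =>
    hΩ.measurableSet.inter measurableSet_ball
  choose C hC hCg using fun i =>
    exists_lintegral_sq_le_of_parallelogram hΩ.measurableSet (hA i) (L i) (hp i).2.1
  refine ⟨∑ i, C i, ENNReal.sum_ne_top.2 fun i _ => hC i, fun g hg => ?_⟩
  refine (lintegral_mono_set hcov).trans ((lintegral_iUnion_le _ _).trans ?_)
  rw [tsum_fintype, Finset.sum_mul]
  exact Finset.sum_le_sum fun i _ => hCg i g hg

/-- The Sobolev inequality for `1 < p < 2`, from the case `p = 1` applied to a power of `φ`. -/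
theorem HasLipschitzBoundary.exists_eLpNorm_le_of_lt_two (hΩ : IsOpen Ω)
    (hb : Bornology.IsBounded Ω) (hL : HasLipschitzBoundary Ω) (hpq : p.HolderConjugate q)
    (hp2 : p < 2) :
    ∃ C : ℝ≥0∞, C ≠ ⊤ ∧ ∀ φ : Plane → ℝ, ContDiff ℝ 1 φ →
      eLpNorm φ (ENNReal.ofReal (2 * p / (2 - p))) (volume.restrict Ω) ≤
        C * (eLpNorm φ (ENNReal.ofReal p) (volume.restrict Ω) +
          eLpNorm (gradient φ) (ENNReal.ofReal p) (volume.restrict Ω)) := by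
  obtain ⟨C, hC, hCg⟩ := hL.exists_lintegral_sq_le hΩ hb
  have hp1 : 1 < p := hpq.lt
  have hp0 : 0 < p := hpq.pos
  have h2p : 0 < 2 - p := by linarith
  -- this power makes both `2 γ` and `(γ - 1) q` equal to the Sobolev exponent
  set γ := p / (2 - p) with hγ
  have hγ1 : 1 < γ := by rw [hγ, one_lt_div h2p]; linarith
  have hq : q = p / (p - 1) := hpq.conjugate_eq
  have hexp : (γ - 1) * q = 2 * γ := by
    have : p - 1 ≠ 0 := by linarith
    rw [hq, hγ]; field_simp; ring
  have hr : 2 * p / (2 - p) = 2 * γ := by rw [hγ]; ring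
  have hCγ : C * ENNReal.ofReal γ ^ 2 ≠ ⊤ := ENNReal.mul_ne_top hC (by simp)
  refine ⟨(C * ENNReal.ofReal γ ^ 2) ^ (1 / 2 : ℝ),
    ENNReal.rpow_ne_top_of_nonneg (by norm_num) hCγ, fun φ hφ => ?_⟩
  have hγ0 : 0 < 2 * γ := by linarith
  rw [hr, eLpNorm_eq_lintegral_rpow_enorm_toReal (by simpa using hγ0) ENNReal.ofReal_ne_top,
    ENNReal.toReal_ofReal hγ0.le]
  set μ := volume.restrict Ω with hμ
  have hfin : IsFiniteMeasure μ := ⟨by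
    rw [hμ, Measure.restrict_apply_univ]; exact hb.measure_lt_top⟩
  set N := ∫⁻ x, ‖φ x‖ₑ ^ (2 * γ) ∂μ
  have hφm : Measurable fun x => ‖φ x‖ₑ := hφ.continuous.enorm.measurable
  have hGm : Measurable fun x => ‖gradient φ x‖ₑ := hφ.continuous_gradient.enorm.measurable
  -- finiteness of `N` is needed below to divide by a power of it
  have hNt : N ≠ ⊤ := by
    obtain ⟨R, hR⟩ := (hb.isCompact_closure.exists_bound_of_continuousOn hφ.continuous.continuousOn)
    refine (lt_of_le_of_lt (lintegral_mono_ae (g := fun _ => ENNReal.ofReal R ^ (2 * γ)) ?_) ?_).ne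
    · filter_upwards [ae_restrict_mem hΩ.measurableSet] with x hx
      refine ENNReal.rpow_le_rpow ?_ hγ0.le
      rw [← ofReal_norm]
      exact ENNReal.ofReal_le_ofReal (hR x (subset_closure hx))
    · rw [lintegral_const]
      exact ENNReal.mul_lt_top (ENNReal.rpow_lt_top_of_nonneg hγ0.le ENNReal.ofReal_ne_top)
        (measure_lt_top _ _)
  set S := eLpNorm φ (ENNReal.ofReal p) μ + eLpNorm (gradient φ) (ENNReal.ofReal p) μ with hS
  have hSle : (∫⁻ x, (‖φ x‖ₑ + ‖gradient φ x‖ₑ) ^ p ∂μ) ^ (1 / p) ≤ S := by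
    refine (ENNReal.lintegral_Lp_add_le hφm.aemeasurable hGm.aemeasurable hp1.le).trans
      (le_of_eq ?_)
    rw [hS, eLpNorm_eq_lintegral_rpow_enorm_toReal (by simpa using hp0) ENNReal.ofReal_ne_top,
      eLpNorm_eq_lintegral_rpow_enorm_toReal (by simpa using hp0) ENNReal.ofReal_ne_top,
      ENNReal.toReal_ofReal hp0.le]
  have hpow : ∀ x, ‖‖φ x‖ ^ γ‖ₑ = ‖φ x‖ₑ ^ γ := by
    intro x
    rw [Real.enorm_eq_ofReal (by positivity), ← ENNReal.ofReal_rpow_of_nonneg (norm_nonneg _)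
      (by linarith), ofReal_norm]
  have hgrad : ∀ x, ‖gradient (fun x => ‖φ x‖ ^ γ) x‖ₑ ≤
      ENNReal.ofReal γ * ‖φ x‖ₑ ^ (γ - 1) * ‖gradient φ x‖ₑ := by
    intro x
    have := norm_fderiv_norm_rpow_le (hφ.differentiable one_ne_zero) (x := x) hγ1
    rw [← ofReal_norm, norm_gradient]
    refine (ENNReal.ofReal_le_ofReal this).trans (le_of_eq ?_)
    rw [ENNReal.ofReal_mul (by positivity), ENNReal.ofReal_mul (by positivity),
      ← ENNReal.ofReal_rpow_of_nonneg (norm_nonneg _) (by linarith), ofReal_norm, ← norm_gradient,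
      ofReal_norm]
  have hsum : ∀ x, ‖‖φ x‖ ^ γ‖ₑ + ‖gradient (fun x => ‖φ x‖ ^ γ) x‖ₑ ≤
      ENNReal.ofReal γ * (‖φ x‖ₑ ^ (γ - 1) * (‖φ x‖ₑ + ‖gradient φ x‖ₑ)) := by
    intro x
    have h1 : ‖φ x‖ₑ ^ γ = ‖φ x‖ₑ ^ (γ - 1) * ‖φ x‖ₑ := by
      conv_lhs => rw [show γ = (γ - 1) + 1 by ring]
      rw [ENNReal.rpow_add_of_nonneg _ _ (by linarith) zero_le_one, ENNReal.rpow_one]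
    have h2 : (1 : ℝ≥0∞) ≤ ENNReal.ofReal γ := by simpa using hγ1.le
    rw [hpow, h1]
    calc ‖φ x‖ₑ ^ (γ - 1) * ‖φ x‖ₑ + ‖gradient (fun x => ‖φ x‖ ^ γ) x‖ₑ
        ≤ ENNReal.ofReal γ * (‖φ x‖ₑ ^ (γ - 1) * ‖φ x‖ₑ) +
          ENNReal.ofReal γ * ‖φ x‖ₑ ^ (γ - 1) * ‖gradient φ x‖ₑ :=
          add_le_add (le_mul_of_one_le_left (by simp) h2) (hgrad x)
      _ = _ := by ring
  have hmain : N ≤ C * ENNReal.ofReal γ ^ 2 * (N ^ (1 / q) * S) ^ 2 := by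
    have h1 := hCg (fun x => ‖φ x‖ ^ γ) (hφ.norm_rpow hγ1)
    have h2 : ∫⁻ x, ‖‖φ x‖ ^ γ‖ₑ ^ 2 ∂μ = N := by
      refine lintegral_congr fun x => ?_
      rw [hpow, ← ENNReal.rpow_natCast, ← ENNReal.rpow_mul]
      congr 1
      push_cast
      ring
    rw [h2] at h1
    have h3 : ∫⁻ x, (‖‖φ x‖ ^ γ‖ₑ + ‖gradient (fun x => ‖φ x‖ ^ γ) x‖ₑ) ∂μ ≤
        ENNReal.ofReal γ * (N ^ (1 / q) * S) := by
      refine (lintegral_mono hsum).trans ?_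
      rw [lintegral_const_mul' _ _ ENNReal.ofReal_ne_top]
      gcongr
      have h4 := ENNReal.lintegral_mul_le_Lp_mul_Lq μ hpq.symm
        (hφm.pow_const (γ - 1)).aemeasurable (hφm.add hGm).aemeasurable
      refine h4.trans (mul_le_mul' (le_of_eq ?_) hSle)
      congr 1
      refine lintegral_congr fun x => ?_
      rw [← ENNReal.rpow_mul, hexp]
    refine h1.trans ?_
    calc C * (∫⁻ x, (‖‖φ x‖ ^ γ‖ₑ + ‖gradient (fun x => ‖φ x‖ ^ γ) x‖ₑ) ∂μ) ^ 2
        ≤ C * (ENNReal.ofReal γ * (N ^ (1 / q) * S)) ^ 2 := by gcongr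
      _ = _ := by ring
  rcases eq_or_ne N 0 with h0 | h0
  · rw [h0, ENNReal.zero_rpow_of_pos (by positivity)]; exact zero_le
  -- dividing by `N ^ (2 / q)` leaves the power `1 - 2 / q = 2 / (2 γ)` of `N`
  have hq0 : 0 < q := hpq.symm.pos
  have hdiv : N ^ (1 - 2 / q) ≤ C * ENNReal.ofReal γ ^ 2 * S ^ 2 := by
    have h1 : N ^ (1 - 2 / q) = N * (N ^ (2 / q))⁻¹ := by
      rw [sub_eq_add_neg, ENNReal.rpow_add _ _ h0 hNt, ENNReal.rpow_one, ENNReal.rpow_neg]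
    have h2 : N ^ (2 / q) ≠ 0 := by simp [h0, hNt]
    have h3 : N ^ (2 / q) ≠ ⊤ := ENNReal.rpow_ne_top_of_nonneg (by positivity) hNt
    rw [h1, ← div_eq_mul_inv, ENNReal.div_le_iff h2 h3]
    refine hmain.trans (le_of_eq ?_)
    rw [mul_pow, ← ENNReal.rpow_natCast (N ^ (1 / q)), ← ENNReal.rpow_mul]
    have : 1 / q * ((2 : ℕ) : ℝ) = 2 / q := by push_cast; ring
    rw [this]
    ring
  have hfinal := ENNReal.rpow_le_rpow hdiv (by norm_num : (0 : ℝ) ≤ 1 / 2)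
  rw [← ENNReal.rpow_mul, ENNReal.mul_rpow_of_nonneg _ (S ^ 2) (by norm_num),
    ← ENNReal.rpow_natCast S, ← ENNReal.rpow_mul S] at hfinal
  have e1 : (1 - 2 / q) * (1 / 2) = 1 / (2 * γ) := by
    have : p - 1 ≠ 0 := by linarith
    rw [hq, hγ]; field_simp; ring
  have e2 : ((2 : ℕ) : ℝ) * (1 / 2) = 1 := by norm_num
  rwa [e1, e2, ENNReal.rpow_one] at hfinal

theorem exists_eLpNorm_le_mul {α : Type*} [MeasurableSpace α] {μ : Measure α} [IsFiniteMeasure μ]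
    {P Q : ℝ≥0∞} (hP : P ≠ 0) (hPQ : P ≤ Q) (hQ : Q ≠ ⊤) :
    ∃ C : ℝ≥0∞, C ≠ ⊤ ∧ ∀ {E : Type} [NormedAddCommGroup E] (f : α → E),
      AEStronglyMeasurable f μ → eLpNorm f P μ ≤ C * eLpNorm f Q μ := by
  refine ⟨μ univ ^ (1 / P.toReal - 1 / Q.toReal), ENNReal.rpow_ne_top_of_nonneg ?_
    (measure_ne_top _ _), fun f hf => ?_⟩
  · exact sub_nonneg.2 (one_div_le_one_div_of_le
      (ENNReal.toReal_pos hP (ne_top_of_le_ne_top hQ hPQ))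
      (ENNReal.toReal_mono hQ hPQ))
  · rw [mul_comm]
    exact eLpNorm_le_eLpNorm_mul_rpow_measure_univ hPQ hf

/-- The Sobolev inequality for `p = 2`, from the case of an exponent `2 t / (t + 2) < 2`. -/
theorem HasLipschitzBoundary.exists_eLpNorm_le_of_eq_two (hΩ : IsOpen Ω)
    (hb : Bornology.IsBounded Ω) (hL : HasLipschitzBoundary Ω) {r : ℝ≥0∞} (hr1 : 1 ≤ r)
    (hr : r ≠ ⊤) :
    ∃ C : ℝ≥0∞, C ≠ ⊤ ∧ ∀ φ : Plane → ℝ, ContDiff ℝ 1 φ →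
      eLpNorm φ r (volume.restrict Ω) ≤
        C * (eLpNorm φ (ENNReal.ofReal 2) (volume.restrict Ω) +
          eLpNorm (gradient φ) (ENNReal.ofReal 2) (volume.restrict Ω)) := by
  have hfin : IsFiniteMeasure (volume.restrict Ω) := ⟨by
    rw [Measure.restrict_apply_univ]; exact hb.measure_lt_top⟩
  set t := max r.toReal 4
  have ht4 : 4 ≤ t := le_max_right _ _
  set p' := 2 * t / (t + 2) with hp'
  have h1 : 1 < p' := by rw [hp', one_lt_div (by linarith)]; linarith
  have h2 : p' < 2 := by rw [hp', div_lt_iff₀ (by linarith)]; linarith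
  have h3 : 2 * p' / (2 - p') = t := by
    have : t + 2 ≠ 0 := by linarith
    have e : 2 - p' = 4 / (t + 2) := by rw [hp']; field_simp; ring
    rw [e, hp']; field_simp; norm_num
  obtain ⟨C, hC, hCφ⟩ := hL.exists_eLpNorm_le_of_lt_two hΩ hb
    (Real.HolderConjugate.conjExponent h1) h2
  rw [h3] at hCφ
  obtain ⟨C₁, hC₁, hφ₁⟩ := exists_eLpNorm_le_mul (μ := volume.restrict Ω) (P := r)
    (Q := ENNReal.ofReal t) (by positivity) (by
      rw [← ENNReal.ofReal_toReal hr]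
      exact ENNReal.ofReal_le_ofReal (le_max_left _ _)) ENNReal.ofReal_ne_top
  obtain ⟨C₂, hC₂, hφ₂⟩ := exists_eLpNorm_le_mul (μ := volume.restrict Ω) (P := ENNReal.ofReal p')
    (Q := ENNReal.ofReal 2) (by simp; linarith) (ENNReal.ofReal_le_ofReal h2.le)
    ENNReal.ofReal_ne_top
  refine ⟨C₁ * (C * C₂), ENNReal.mul_ne_top hC₁ (ENNReal.mul_ne_top hC hC₂), fun φ hφ => ?_⟩
  calc eLpNorm φ r (volume.restrict Ω)
      ≤ C₁ * eLpNorm φ (ENNReal.ofReal t) (volume.restrict Ω) :=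
        hφ₁ φ hφ.continuous.aestronglyMeasurable
    _ ≤ C₁ * (C * (C₂ * eLpNorm φ (ENNReal.ofReal 2) (volume.restrict Ω) +
          C₂ * eLpNorm (gradient φ) (ENNReal.ofReal 2) (volume.restrict Ω))) := by
        gcongr
        refine (hCφ φ hφ).trans ?_
        gcongr
        · exact hφ₂ φ hφ.continuous.aestronglyMeasurable
        · exact hφ₂ _ hφ.continuous_gradient.aestronglyMeasurable
    _ = _ := by ring

theorem enorm_integral_uniformOn_le (hpq : p.HolderConjugate q) {B : Set Plane} (hB0 : volume B ≠ 0)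
    (hB1 : volume B ≠ ⊤) (hBΩ : B ⊆ Ω) {φ : Plane → ℝ} (hφ : Continuous φ) :
    ‖∫ z, φ z ∂(uniformOn B)‖ₑ ≤
      (volume B)⁻¹ ^ (1 / p) * eLpNorm φ (ENNReal.ofReal p) (volume.restrict Ω) := by
  have := isProbabilityMeasure_uniformOn hB0 hB1
  have hp : 0 ≤ 1 / p := by have := hpq.pos; positivity
  have h1 : ‖∫ z, φ z ∂(uniformOn B)‖ₑ ^ p ≤ (volume B)⁻¹ * ∫⁻ z in Ω, ‖φ z‖ₑ ^ p := by
    refine (ENNReal.rpow_le_rpow (enorm_integral_le_lintegral_enorm _) hpq.nonneg).trans ?_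
    refine (rpow_lintegral_le hpq hφ.enorm.measurable.aemeasurable).trans ?_
    rw [lintegral_smul_measure, smul_eq_mul]
    gcongr
  have h2 := ENNReal.rpow_le_rpow h1 hp
  rwa [← ENNReal.rpow_mul, mul_one_div_cancel hpq.ne_zero, ENNReal.rpow_one,
    ENNReal.mul_rpow_of_nonneg _ _ hp, ← ENNReal.toReal_ofReal hpq.nonneg,
    ← eLpNorm_eq_lintegral_rpow_enorm_toReal (by simpa using hpq.pos) ENNReal.ofReal_ne_top,
    ENNReal.toReal_ofReal hpq.nonneg] at h2

theorem volume_ball_ne_zero (z : Plane) {η : ℝ} (hη : 0 < η) : volume (Metric.ball z η) ≠ 0 :=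
  (Metric.measure_ball_pos volume z hη).ne'

/-- The distances between the points of two bounded sets are bounded. -/
theorem exists_enorm_sub_le {A B : Set Plane} (hA : Bornology.IsBounded A)
    (hB : Bornology.IsBounded B) : ∃ D : ℝ≥0, ∀ x ∈ A, ∀ z ∈ B, ‖z - x‖ₑ ≤ D := by
  obtain ⟨R, hR⟩ := hA.exists_norm_le
  obtain ⟨S, hS⟩ := hB.exists_norm_le
  refine ⟨(S + R).toNNReal, fun x hx z hz => ?_⟩
  rw [← ofReal_norm]
  exact ENNReal.ofReal_le_ofReal ((norm_sub_le _ _).trans (add_le_add (hS z hz) (hR x hx)))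

/-- The Sobolev inequality for `p > 2`, from the Morrey inequality on each piece. -/
theorem HasLipschitzBoundary.exists_eLpNorm_top_le (hΩ : IsOpen Ω)
    (hb : Bornology.IsBounded Ω) (hL : HasLipschitzBoundary Ω) (hpq : p.HolderConjugate q)
    (hp2 : 2 < p) :
    ∃ C : ℝ≥0∞, C ≠ ⊤ ∧ ∀ φ : Plane → ℝ, ContDiff ℝ 1 φ →
      eLpNorm φ ⊤ (volume.restrict Ω) ≤
        C * (eLpNorm φ (ENNReal.ofReal p) (volume.restrict Ω) +
          eLpNorm (gradient φ) (ENNReal.ofReal p) (volume.restrict Ω)) := by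
  obtain ⟨n, c, z, η, L, hcov, hp⟩ := hL.exists_pieces hΩ hb
  have hloc : ∀ i, ∃ C : ℝ≥0∞, C ≠ ⊤ ∧ ∀ φ : Plane → ℝ, ContDiff ℝ 1 φ →
      ∀ x ∈ Ω ∩ Metric.ball (c i) (η i), ‖φ x‖ₑ ≤
        C * (eLpNorm φ (ENNReal.ofReal p) (volume.restrict Ω) +
          eLpNorm (gradient φ) (ENNReal.ofReal p) (volume.restrict Ω)) := by
    intro i
    have hB0 := volume_ball_ne_zero (z i) (hp i).1
    obtain ⟨D, hD⟩ := exists_enorm_sub_le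
      (hb.subset (inter_subset_left (t := Metric.ball (c i) (η i))))
      (Metric.isBounded_ball (x := z i) (r := η i))
    obtain ⟨C, hC, hCφ⟩ := exists_enorm_sub_mean_le hΩ.measurableSet measurableSet_ball hpq hp2
      Metric.isBounded_ball hB0 hD (hp i).2.2
    set C' := (volume (Metric.ball (z i) (η i)))⁻¹ ^ (1 / p)
    have hC't : C' ≠ ⊤ := ENNReal.rpow_ne_top_of_nonneg
      (by have := hpq.pos; positivity) (ENNReal.inv_ne_top.2 hB0)
    refine ⟨C + C', ENNReal.add_ne_top.2 ⟨hC, hC't⟩, fun φ hφ x hx => ?_⟩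
    have hBΩ : Metric.ball (z i) (η i) ⊆ Ω := fun y hy => by
      simpa using (hp i).2.2 x hx y hy 1 ⟨zero_le_one, le_rfl⟩
    have h1 := hCφ φ hφ x hx
    have h2 := enorm_integral_uniformOn_le hpq hB0 measure_ball_lt_top.ne hBΩ hφ.continuous
    have hG : (∫⁻ y in Ω, ‖gradient φ y‖ₑ ^ p) ^ (1 / p) =
        eLpNorm (gradient φ) (ENNReal.ofReal p) (volume.restrict Ω) := by
      rw [eLpNorm_eq_lintegral_rpow_enorm_toReal (by simpa using hpq.pos) ENNReal.ofReal_ne_top,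
        ENNReal.toReal_ofReal hpq.nonneg]
    rw [hG] at h1
    set m := ∫ y, φ y ∂(uniformOn (Metric.ball (z i) (η i)))
    calc ‖φ x‖ₑ = ‖(φ x - m) + m‖ₑ := by rw [sub_add_cancel]
      _ ≤ _ := enorm_add_le _ _
      _ ≤ _ := add_le_add h1 h2
      _ ≤ (C + C') * eLpNorm (gradient φ) (ENNReal.ofReal p) (volume.restrict Ω) +
          (C + C') * eLpNorm φ (ENNReal.ofReal p) (volume.restrict Ω) := by
          gcongr
          · exact le_self_add
          · exact le_add_self
      _ = _ := by ring
  choose C hC hCφ using hloc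
  refine ⟨∑ i, C i, ENNReal.sum_ne_top.2 fun i _ => hC i, fun φ hφ => ?_⟩
  rw [eLpNorm_exponent_top]
  refine eLpNormEssSup_le_of_ae_enorm_bound ?_
  filter_upwards [ae_restrict_mem hΩ.measurableSet] with x hx
  obtain ⟨i, hi⟩ := mem_iUnion.1 (hcov hx)
  refine (hCφ i φ hφ x hi).trans ?_
  gcongr
  exact Finset.single_le_sum (f := C) (fun _ _ => zero_le) (Finset.mem_univ i)

/-- The **Sobolev inequality** on a bounded Lipschitz domain of the plane. -/
theorem HasLipschitzBoundary.exists_sobolev (hΩ : IsOpen Ω) (hb : Bornology.IsBounded Ω)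
    (hL : HasLipschitzBoundary Ω) (hpq : p.HolderConjugate q) {r : ℝ≥0∞}
    (hr : IsSobolevExponent p r) (hr1 : 1 ≤ r) :
    ∃ C : ℝ≥0∞, C ≠ ⊤ ∧ ∀ φ : Plane → ℝ, ContDiff ℝ 1 φ →
      eLpNorm φ r (volume.restrict Ω) ≤
        C * (eLpNorm φ (ENNReal.ofReal p) (volume.restrict Ω) +
          eLpNorm (gradient φ) (ENNReal.ofReal p) (volume.restrict Ω)) := by
  rcases hr with ⟨hp, rfl⟩ | ⟨rfl, h⟩ | ⟨hp, rfl⟩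
  · exact hL.exists_eLpNorm_le_of_lt_two hΩ hb hpq hp
  · exact hL.exists_eLpNorm_le_of_eq_two hΩ hb hr1 h.ne
  · exact hL.exists_eLpNorm_top_le hΩ hb hpq hp

/-- The Sobolev inequality passes to the closure of the smooth functions, by Fatou's lemma. -/
theorem HasLipschitzBoundary.exists_sobolev_vanishingGraph [Fact (1 ≤ ENNReal.ofReal p)]
    (hΩ : IsOpen Ω) (hb : Bornology.IsBounded Ω)
    (hL : HasLipschitzBoundary Ω) (hpq : p.HolderConjugate q) {r : ℝ≥0∞}
    (hr : IsSobolevExponent p r) (hr1 : 1 ≤ r) :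
    ∃ C : ℝ≥0∞, C ≠ ⊤ ∧ ∀ z ∈ vanishingGraph Ω K p,
      eLpNorm z.1 r (volume.restrict Ω) ≤ C * (‖z.1‖ₑ + ‖z.2‖ₑ) := by
  obtain ⟨C, hC, hCφ⟩ := hL.exists_sobolev hΩ hb hpq hr hr1
  refine ⟨C, hC, fun z hz => ?_⟩
  obtain ⟨w, hw, hlim⟩ := mem_closure_iff_seq_limit.1
    (by simpa [vanishingGraph, ← SetLike.mem_coe, Submodule.topologicalClosure_coe] using hz)
  have hlim1 : Tendsto (fun n => (w n).1) atTop (𝓝 z.1) := (continuous_fst.tendsto z).comp hlim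
  have hlim2 : Tendsto (fun n => (w n).2) atTop (𝓝 z.2) := (continuous_snd.tendsto z).comp hlim
  obtain ⟨ns, hns, hae⟩ := (tendstoInMeasure_of_tendsto_Lp hlim1).exists_seq_tendsto_ae
  refine (Lp.eLpNorm_lim_le_liminf_eLpNorm (fun n => Lp.aestronglyMeasurable _) _ hae).trans ?_
  have hle : ∀ n, eLpNorm (w n).1 r (volume.restrict Ω) ≤ C * (‖(w n).1‖ₑ + ‖(w n).2‖ₑ) := by
    intro n
    obtain ⟨φ, h1, -, -, h4, h5⟩ := hw n
    rw [Lp.enorm_def, Lp.enorm_def, eLpNorm_congr_ae h4, eLpNorm_congr_ae h4, eLpNorm_congr_ae h5]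
    exact hCφ φ (h1.of_le (by norm_num))
  have hT : Tendsto (fun n => C * (‖(w (ns n)).1‖ₑ + ‖(w (ns n)).2‖ₑ)) atTop
      (𝓝 (C * (‖z.1‖ₑ + ‖z.2‖ₑ))) :=
    ENNReal.Tendsto.const_mul ((hlim1.enorm.add hlim2.enorm).comp hns.tendsto_atTop) (Or.inr hC)
  exact (liminf_le_liminf (Eventually.of_forall fun n => hle (ns n))).trans hT.liminf_eq.le

/-- The load `u ↦ ∫ u f` is a bounded functional on `W^{1,p}_K(Ω)`. -/
theorem HasLipschitzBoundary.exists_load_bound [Fact (1 ≤ ENNReal.ofReal p)]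
    (hΩ : IsOpen Ω) (hb : Bornology.IsBounded Ω)
    (hL : HasLipschitzBoundary Ω) (hpq : p.HolderConjugate q) {r s : ℝ≥0∞}
    (hr : IsSobolevExponent p r) (hrs : r.HolderConjugate s) {f : Plane → ℝ}
    (hf : MemLp f s (volume.restrict Ω)) :
    ∃ C : ℝ, ∀ z ∈ vanishingGraph Ω K p, IntegrableOn (fun x => z.1 x * f x) Ω ∧
      |∫ x in Ω, z.1 x * f x| ≤ C * ‖z‖ := by
  obtain ⟨C, hC, hCz⟩ := hL.exists_sobolev_vanishingGraph (K := K) hΩ hb hpq hr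
    (ENNReal.HolderConjugate.one_le r s)
  refine ⟨C.toReal * 2 * (eLpNorm f s (volume.restrict Ω)).toReal, fun z hz => ?_⟩
  have h1 := hCz z hz
  have hfin : C * (‖z.1‖ₑ + ‖z.2‖ₑ) ≠ ⊤ := ENNReal.mul_ne_top hC (by simp)
  have hz1 : MemLp z.1 r (volume.restrict Ω) :=
    ⟨Lp.aestronglyMeasurable _, h1.trans_lt hfin.lt_top⟩
  have hint : IntegrableOn (fun x => z.1 x * f x) Ω := hz1.integrable_mul hf
  refine ⟨hint, ?_⟩
  have h2 : ‖∫ x in Ω, z.1 x * f x‖ₑ ≤ C * (‖z.1‖ₑ + ‖z.2‖ₑ) * eLpNorm f s (volume.restrict Ω) := by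
    refine (enorm_integral_le_lintegral_enorm _).trans ?_
    rw [← eLpNorm_one_eq_lintegral_enorm]
    refine (eLpNorm_smul_le_mul_eLpNorm (p := r) (q := s) (r := 1) hf.1 hz1.1).trans ?_
    gcongr
  have h3 : C * (‖z.1‖ₑ + ‖z.2‖ₑ) * eLpNorm f s (volume.restrict Ω) ≠ ⊤ :=
    ENNReal.mul_ne_top hfin hf.2.ne
  have h4 := ENNReal.toReal_mono h3 h2
  rw [toReal_enorm, Real.norm_eq_abs, ENNReal.toReal_mul, ENNReal.toReal_mul,
    ENNReal.toReal_add (by simp) (by simp), toReal_enorm, toReal_enorm] at h4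
  refine h4.trans ?_
  have e1 : ‖z.1‖ ≤ ‖z‖ := norm_fst_le z
  have e2 : ‖z.2‖ ≤ ‖z‖ := norm_snd_le z
  calc C.toReal * (‖z.1‖ + ‖z.2‖) * (eLpNorm f s (volume.restrict Ω)).toReal
      ≤ C.toReal * (‖z‖ + ‖z‖) * (eLpNorm f s (volume.restrict Ω)).toReal := by gcongr
    _ = _ := by ring

/-! ### The gradients of `W^{1,p}_K(Ω)` form a closed subspace -/

/-- Integration over a measurable set `B ⊆ Ω`, normalized, as a functional on `L^p(Ω)`. -/
theorem exists_mean_functional [Fact (1 ≤ ENNReal.ofReal p)] (hpq : p.HolderConjugate q)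
    (hb : Bornology.IsBounded Ω) {B : Set Plane} (hB : MeasurableSet B)
    (hBΩ : B ⊆ Ω) :
    ∃ m : Lp ℝ (ENNReal.ofReal p) (volume.restrict Ω) →L[ℝ] ℝ,
      ∀ u, m u = ∫ z, u z ∂(uniformOn B) := by
  have hfin : IsFiniteMeasure (volume.restrict Ω) := ⟨by
    rw [Measure.restrict_apply_univ]; exact hb.measure_lt_top⟩
  have := hpq.ennrealOfReal
  have := hpq.symm.ennrealOfReal
  have : Fact (1 ≤ ENNReal.ofReal q) := ⟨by simpa using hpq.symm.lt.le⟩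
  have hBt : volume.restrict Ω B ≠ ⊤ := measure_ne_top _ _
  refine ⟨(ContinuousLinearMap.lsmul ℝ ℝ : ℝ →L[ℝ] ℝ →L[ℝ] ℝ).lpPairing (volume.restrict Ω)
    (ENNReal.ofReal q) (ENNReal.ofReal p)
    (indicatorConstLp (ENNReal.ofReal q) hB hBt ((volume B)⁻¹.toReal)), fun u => ?_⟩
  rw [ContinuousLinearMap.lpPairing_eq_integral, integral_smul_measure, ← integral_smul]
  have h1 : (fun x => ContinuousLinearMap.lsmul ℝ ℝ
      (indicatorConstLp (ENNReal.ofReal q) hB hBt ((volume B)⁻¹.toReal) x) (u x))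
      =ᵐ[volume.restrict Ω] B.indicator fun x => (volume B)⁻¹.toReal • u x := by
    filter_upwards [indicatorConstLp_coeFn (p := ENNReal.ofReal q) (hs := hB) (hμs := hBt)
      (c := (volume B)⁻¹.toReal)] with x hx
    rw [hx]
    by_cases h : x ∈ B <;> simp [h]
  rw [integral_congr_ae h1, integral_indicator hB, Measure.restrict_restrict_of_subset hBΩ]

/-- The value on each piece of a step function built on a partition. -/
theorem ae_sum_smul_indicatorConstLp {α : Type*} [MeasurableSpace α] {μ : Measure α}
    [IsFiniteMeasure μ] {P : ℝ≥0∞} {n : ℕ} {Q : Fin n → Set α} (hQm : ∀ i, MeasurableSet (Q i))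
    (hQd : Pairwise (Function.onFun Disjoint Q)) (a : Fin n → ℝ) :
    ∀ᵐ x ∂μ, ∀ i, x ∈ Q i →
      (∑ i, a i • indicatorConstLp P (hQm i) (measure_ne_top μ _) (1 : ℝ) : Lp ℝ P μ) x = a i := by
  have hw : ∀ᵐ x ∂μ, ∀ i, indicatorConstLp P (hQm i) (measure_ne_top μ _) (1 : ℝ) x =
      (Q i).indicator (fun _ => (1 : ℝ)) x := ae_all_iff.2 fun i => indicatorConstLp_coeFn
  have hs : ∀ᵐ x ∂μ, ∀ i,
      (a i • indicatorConstLp P (hQm i) (measure_ne_top μ _) (1 : ℝ) : Lp ℝ P μ) x =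
        a i * indicatorConstLp P (hQm i) (measure_ne_top μ _) (1 : ℝ) x :=
    ae_all_iff.2 fun i => Lp.coeFn_smul _ _
  filter_upwards [hw, hs, Lp.coeFn_finsetSum Finset.univ fun i =>
    a i • indicatorConstLp P (hQm i) (measure_ne_top μ _) (1 : ℝ)] with x e1 e2 e3 i hi
  rw [e3, Finset.sum_apply, Finset.sum_eq_single i]
  · rw [e2, e1, indicator_of_mem hi, mul_one]
  · intro j _ hji
    rw [e2, e1, indicator_of_notMem (fun hj => Set.disjoint_left.1 (hQd hji) hj hi), mul_zero]
  · exact fun h => absurd (Finset.mem_univ i) h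

/-- A Lipschitz domain has a finite measurable partition such that, on each piece `Q i`, functions
are close to their mean over a ball `B i` as soon as their gradient is small on `Ω`. -/
theorem HasLipschitzBoundary.exists_partition (hΩ : IsOpen Ω) (hb : Bornology.IsBounded Ω)
    (hL : HasLipschitzBoundary Ω) (hpq : p.HolderConjugate q) :
    ∃ (n : ℕ) (Q B : Fin n → Set Plane) (C : ℝ≥0∞), C ≠ ⊤ ∧ (∀ i, MeasurableSet (Q i)) ∧
      Pairwise (Function.onFun Disjoint Q) ∧ Ω ⊆ (⋃ i, Q i) ∧ (∀ i, MeasurableSet (B i)) ∧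
      (∀ i, (Q i).Nonempty → B i ⊆ Ω) ∧ (∀ i, Q i ⊆ Ω) ∧
      ∀ φ : Plane → ℝ, ContDiff ℝ 1 φ →
        ∑ i, ∫⁻ x in Q i, ‖φ x - ∫ z, φ z ∂(uniformOn (B i))‖ₑ ^ p ≤
          C * ∫⁻ y in Ω, ‖gradient φ y‖ₑ ^ p := by
  obtain ⟨n, c, y, η, L, hcov, hp⟩ := hL.exists_pieces hΩ hb
  set S : Fin n → Set Plane := fun i => Ω ∩ Metric.ball (c i) (η i)
  have hSm : ∀ i, MeasurableSet (S i) := fun i => hΩ.measurableSet.inter measurableSet_ball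
  have hQS : ∀ i, disjointed S i ⊆ S i := fun i => disjointed_subset S i
  have hB0 : ∀ i, volume (Metric.ball (y i) (η i)) ≠ 0 := fun i =>
    volume_ball_ne_zero (y i) (hp i).1
  choose D hD using fun i => exists_enorm_sub_le
    (hb.subset (inter_subset_left (t := Metric.ball (c i) (η i))))
    (Metric.isBounded_ball (x := y i) (r := η i))
  let C : Fin n → ℝ≥0∞ := fun i =>
    (D i : ℝ≥0∞) ^ p * (4 * (1 + (volume (Metric.ball (y i) (η i)))⁻¹ * volume (S i)))
  refine ⟨n, disjointed S, fun i => Metric.ball (y i) (η i), ∑ i, C i,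
    ENNReal.sum_ne_top.2 fun i _ => ?_,
    fun i => disjointedRec (p := MeasurableSet) (fun _ j h => h.diff (hSm j)) (hSm i),
    disjoint_disjointed S, by rwa [iUnion_disjointed], fun i => measurableSet_ball,
    fun i ⟨x, hx⟩ z hz => ?_, fun i => (hQS i).trans inter_subset_left, fun φ hφ => ?_⟩
  · exact ENNReal.mul_ne_top (ENNReal.rpow_ne_top_of_nonneg hpq.nonneg ENNReal.coe_ne_top)
      (ENNReal.mul_ne_top (by simp) (ENNReal.add_ne_top.2 ⟨by simp, ENNReal.mul_ne_top
        (ENNReal.inv_ne_top.2 (hB0 i)) (hb.subset inter_subset_left).measure_lt_top.ne⟩))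
  · simpa using (hp i).2.2 x (hQS i hx) z hz 1 ⟨zero_le_one, le_rfl⟩
  · rw [Finset.sum_mul]
    exact Finset.sum_le_sum fun i _ => (lintegral_mono_set (hQS i)).trans
      (lintegral_rpow_sub_mean_le hΩ.measurableSet (hSm i) measurableSet_ball hpq
        Metric.isBounded_ball (hB0 i) (hD i) (hp i).2.2 hφ)

/-- A Lipschitz domain carries a projection onto functions that are constant on the pieces of a
finite partition and that differ from a function of `W^{1,p}_K(Ω)` by at most a multiple of its
gradient. -/
theorem HasLipschitzBoundary.exists_poincare [Fact (1 ≤ ENNReal.ofReal p)]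
    (hΩ : IsOpen Ω) (hb : Bornology.IsBounded Ω)
    (hL : HasLipschitzBoundary Ω) (hpq : p.HolderConjugate q) :
    ∃ (F : Submodule ℝ (Lp ℝ (ENNReal.ofReal p) (volume.restrict Ω)))
      (A : Lp ℝ (ENNReal.ofReal p) (volume.restrict Ω) →L[ℝ]
        Lp ℝ (ENNReal.ofReal p) (volume.restrict Ω)) (C : ℝ),
      FiniteDimensional ℝ F ∧ (∀ u, A u ∈ F) ∧
      ∀ z ∈ vanishingGraph Ω K p, ‖z.1 - A z.1‖ ≤ C * ‖z.2‖ := by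
  have hfin : IsFiniteMeasure (volume.restrict Ω) := ⟨by
    rw [Measure.restrict_apply_univ]; exact hb.measure_lt_top⟩
  obtain ⟨n, Q, B, C, hCt, hQm, hQd, hQcov, hBm, hBΩ, hQΩ, hφ⟩ := hL.exists_partition hΩ hb hpq
  have hm : ∀ i, ∃ m : Lp ℝ (ENNReal.ofReal p) (volume.restrict Ω) →L[ℝ] ℝ,
      (Q i).Nonempty → ∀ u, m u = ∫ z, u z ∂(uniformOn (B i)) := by
    intro i
    by_cases h : (Q i).Nonempty
    · obtain ⟨m, hm⟩ := exists_mean_functional (p := p) hpq hb (hBm i) (hBΩ i h)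
      exact ⟨m, fun _ => hm⟩
    · exact ⟨0, fun h' => absurd h' h⟩
  choose m hm using hm
  let w : Fin n → Lp ℝ (ENNReal.ofReal p) (volume.restrict Ω) := fun i =>
    indicatorConstLp (ENNReal.ofReal p) (hQm i) (measure_ne_top _ _) 1
  obtain ⟨A, hAapp⟩ : ∃ A : Lp ℝ (ENNReal.ofReal p) (volume.restrict Ω) →L[ℝ]
      Lp ℝ (ENNReal.ofReal p) (volume.restrict Ω), ∀ u, A u = ∑ i, m i u • w i :=
    ⟨∑ i, (m i).smulRight (w i), fun u => by simp⟩
  have hp0 : 0 ≤ 1 / p := by have := hpq.pos; positivity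
  have hCp : C ^ (1 / p) ≠ ⊤ := ENNReal.rpow_ne_top_of_nonneg hp0 hCt
  refine ⟨Submodule.span ℝ (range w), A, (C ^ (1 / p)).toReal,
    FiniteDimensional.span_of_finite ℝ (finite_range w), fun u => ?_, ?_⟩
  · rw [hAapp]
    exact Submodule.sum_mem _ fun i _ => Submodule.smul_mem _ _
      (Submodule.subset_span (mem_range_self i))
  have hcl : IsClosed {z : Lp ℝ (ENNReal.ofReal p) (volume.restrict Ω) ×
      Lp Plane (ENNReal.ofReal p) (volume.restrict Ω) |
      ‖z.1 - A z.1‖ ≤ (C ^ (1 / p)).toReal * ‖z.2‖} :=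
    isClosed_le ((continuous_fst.sub (A.continuous.comp continuous_fst)).norm)
      (continuous_const.mul continuous_snd.norm)
  refine fun z hz => closure_minimal ?_ hcl hz
  rintro z ⟨φ, h1, -, -, h4, h5⟩
  -- on the piece `Q i`, the projection of `φ` is the mean of `φ` over `B i`
  have hval : ∀ᵐ x ∂(volume.restrict Ω), ∀ i, x ∈ Q i →
      (z.1 - A z.1) x = φ x - ∫ t, φ t ∂(uniformOn (B i)) := by
    filter_upwards [ae_sum_smul_indicatorConstLp (P := ENNReal.ofReal p) (μ := volume.restrict Ω)
      hQm hQd (fun i => m i z.1), h4, Lp.coeFn_sub z.1 (A z.1)] with x e2 e3 e4 i hi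
    rw [e4, Pi.sub_apply, hAapp, e2 i hi, e3, hm i ⟨x, hi⟩]
    congr 1
    refine integral_congr_ae (Measure.ae_smul_measure ?_ _)
    exact ae_restrict_of_ae_restrict_of_subset (hBΩ i ⟨x, hi⟩) h4
  have hint : ∫⁻ x in Ω, ‖(z.1 - A z.1) x‖ₑ ^ p ≤ C * ∫⁻ x in Ω, ‖gradient φ x‖ₑ ^ p := by
    have hsplit : ∫⁻ x in Ω, ‖(z.1 - A z.1) x‖ₑ ^ p ≤
        ∑ i, ∫⁻ x in Q i, ‖(z.1 - A z.1) x‖ₑ ^ p := by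
      refine (lintegral_mono_set hQcov).trans ((lintegral_iUnion_le _ _).trans ?_)
      rw [tsum_fintype]
    refine (hsplit.trans (Finset.sum_le_sum fun i _ => ?_)).trans
      (hφ φ (h1.of_le (by norm_num)))
    refine (lintegral_congr_ae ?_).le
    filter_upwards [ae_restrict_of_ae_restrict_of_subset (hQΩ i) hval,
      ae_restrict_mem (hQm i)] with x hx hxi
    rw [hx i hxi]
  have hnorm : ‖z.1 - A z.1‖ₑ ≤ C ^ (1 / p) * ‖z.2‖ₑ := by
    rw [Lp.enorm_def, Lp.enorm_def, eLpNorm_congr_ae h5,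
      eLpNorm_eq_lintegral_rpow_enorm_toReal (by simpa using hpq.pos) ENNReal.ofReal_ne_top,
      eLpNorm_eq_lintegral_rpow_enorm_toReal (by simpa using hpq.pos) ENNReal.ofReal_ne_top,
      ENNReal.toReal_ofReal hpq.nonneg, ← ENNReal.mul_rpow_of_nonneg _ _ hp0]
    exact ENNReal.rpow_le_rpow hint hp0
  have := ENNReal.toReal_mono (ENNReal.mul_ne_top hCp (by simp)) hnorm
  rwa [ENNReal.toReal_mul, toReal_enorm, toReal_enorm] at this

/-- Let `V` be a closed subspace of `X × Y` whose elements have a first component controlled by the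
second one up to a projection onto a finite-dimensional space. Then the projection of `V` to `Y` is
closed: if the second components of a sequence converge, so do the first ones up to a
finite-dimensional correction, and the sum of a closed and a finite-dimensional subspace is
closed. -/
theorem Submodule.isClosed_map_snd_of_finiteDimensional {X Y : Type*} [NormedAddCommGroup X]
    [NormedSpace ℝ X] [CompleteSpace X] [NormedAddCommGroup Y] [NormedSpace ℝ Y]
    {V : Submodule ℝ (X × Y)} (hV : IsClosed (V : Set (X × Y))) (F : Submodule ℝ X)
    [FiniteDimensional ℝ F] (A : X →L[ℝ] X) (hA : ∀ u, A u ∈ F) (C : ℝ)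
    (hC : ∀ z ∈ V, ‖z.1 - A z.1‖ ≤ C * ‖z.2‖) :
    IsClosed (V.map (LinearMap.snd ℝ X Y) : Set Y) := by
  let F' := F.map (LinearMap.inl ℝ X Y)
  have hsup : IsClosed ((V ⊔ F' : Submodule ℝ (X × Y)) : Set (X × Y)) :=
    Submodule.isClosed_sup_finiteDimensional V F' hV
  refine isClosed_of_closure_subset fun G hG => ?_
  obtain ⟨g, hg, hlim⟩ := mem_closure_iff_seq_limit.1 hG
  choose z hz hzg using fun n => hg n
  have hzg' : ∀ n, (z n).2 = g n := hzg
  have hcau : CauchySeq fun n => (z n).1 - A (z n).1 := by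
    have hgc : CauchySeq fun n => |C| • g n := (hlim.const_smul |C|).cauchySeq
    rw [Metric.cauchySeq_iff] at hgc ⊢
    intro ε hε
    obtain ⟨N, hN⟩ := hgc ε hε
    refine ⟨N, fun i hi j hj => lt_of_le_of_lt ?_ (hN i hi j hj)⟩
    have h1 := hC (z i - z j) (V.sub_mem (hz i) (hz j))
    rw [dist_eq_norm, dist_eq_norm, ← smul_sub, norm_smul, ← hzg', ← hzg',
      Real.norm_eq_abs, abs_abs]
    have h2 : (z i).1 - A (z i).1 - ((z j).1 - A (z j).1) = (z i - z j).1 - A (z i - z j).1 := by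
      rw [Prod.fst_sub, map_sub]; abel
    rw [h2]
    exact h1.trans (mul_le_mul_of_nonneg_right (le_abs_self C) (norm_nonneg _))
  obtain ⟨u, hu⟩ := cauchySeq_tendsto_of_complete hcau
  have hmem : (u, G) ∈ V ⊔ F' := by
    refine hsup.mem_of_tendsto (hu.prodMk_nhds hlim) (Eventually.of_forall fun n => ?_)
    have : ((z n).1 - A (z n).1, g n) = z n + LinearMap.inl ℝ X Y (-(A (z n).1)) := by
      ext1
      · simp [sub_eq_add_neg]
      · simp [hzg']
    rw [this]
    exact Submodule.add_mem_sup (hz n) (Submodule.mem_map_of_mem (F.neg_mem (hA _)))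
  obtain ⟨a, ha, b, ⟨b', -, rfl⟩, hab⟩ := Submodule.mem_sup.1 hmem
  refine ⟨a, ha, ?_⟩
  have := congrArg Prod.snd hab
  simpa using this

/-- The space of gradients of `W^{1,p}_K(Ω)` is closed in `L^p`. -/
theorem HasLipschitzBoundary.isClosed_range_gradient [Fact (1 ≤ ENNReal.ofReal p)]
    (hΩ : IsOpen Ω) (hb : Bornology.IsBounded Ω)
    (hL : HasLipschitzBoundary Ω) (hpq : p.HolderConjugate q) :
    IsClosed (((vanishingGraph Ω K p).map (LinearMap.snd ℝ
      (Lp ℝ (ENNReal.ofReal p) (volume.restrict Ω))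
      (Lp Plane (ENNReal.ofReal p) (volume.restrict Ω))) : Submodule ℝ
      (Lp Plane (ENNReal.ofReal p) (volume.restrict Ω))) :
      Set (Lp Plane (ENNReal.ofReal p) (volume.restrict Ω))) := by
  obtain ⟨F, A, C, hF, hA, hC⟩ := hL.exists_poincare (K := K) hΩ hb hpq
  exact Submodule.isClosed_map_snd_of_finiteDimensional
    (Submodule.isClosed_topologicalClosure (testGraph Ω K p)) F A hA C hC

/-! ### Minimization of a convex energy on a closed subspace of `L^p` -/

section UniformConvexity

variable {E : Type*} [NormedAddCommGroup E] [InnerProductSpace ℝ E]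

theorem norm_rpow_midpoint_lt (hp : 1 < p) {a b : E} (hab : a ≠ b) :
    ‖(1 / 2 : ℝ) • (a + b)‖ ^ p < (‖a‖ ^ p + ‖b‖ ^ p) / 2 := by
  have hp0 : 0 < p := by linarith
  by_cases h : ‖a‖ = ‖b‖
  · have h1 : ‖(1 / 2 : ℝ) • (a + b)‖ < ‖a‖ := (norm_midpoint_lt_iff h).2 hab
    rw [← h, add_self_div_two]
    exact Real.rpow_lt_rpow (norm_nonneg _) h1 hp0
  · have h1 : ‖(1 / 2 : ℝ) • (a + b)‖ ≤ (1 / 2 : ℝ) • ‖a‖ + (1 / 2 : ℝ) • ‖b‖ := by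
      rw [norm_smul, smul_eq_mul, smul_eq_mul, ← mul_add]
      norm_num
      exact norm_add_le a b
    refine (Real.rpow_le_rpow (norm_nonneg _) h1 hp0.le).trans_lt ?_
    have := (strictConvexOn_rpow hp).2 (mem_Ici.2 (norm_nonneg a)) (mem_Ici.2 (norm_nonneg b)) h
      (by norm_num : (0 : ℝ) < 1 / 2) (by norm_num : (0 : ℝ) < 1 / 2) (by norm_num)
    refine this.trans_le (le_of_eq ?_)
    simp only [smul_eq_mul]
    ring

/-- Pointwise uniform convexity of `‖·‖ ^ p`: up to a small multiple of `‖a‖ ^ p + ‖b‖ ^ p`, the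
quantity `‖a - b‖ ^ p` is controlled by the convexity gap at the midpoint. By homogeneity it is
enough to consider a compact set of pairs, on which strict convexity bounds the gap below. -/
theorem exists_norm_sub_rpow_le [FiniteDimensional ℝ E] (hp : 1 < p) {ε : ℝ} (hε : 0 < ε) :
    ∃ M : ℝ, 0 ≤ M ∧ ∀ a b : E, ‖a - b‖ ^ p ≤ ε * (‖a‖ ^ p + ‖b‖ ^ p) +
      M * ((‖a‖ ^ p + ‖b‖ ^ p) / 2 - ‖(1 / 2 : ℝ) • (a + b)‖ ^ p) := by
  have hp0 : 0 < p := by linarith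
  have hgap0 : ∀ a b : E, 0 ≤ (‖a‖ ^ p + ‖b‖ ^ p) / 2 - ‖(1 / 2 : ℝ) • (a + b)‖ ^ p := by
    intro a b
    rcases eq_or_ne a b with rfl | h
    · rw [← two_smul ℝ a, smul_smul]; norm_num
    · exact (sub_pos.2 (norm_rpow_midpoint_lt hp h)).le
  -- the inequality on the unit sphere of `E × E`
  obtain ⟨M, hM0, hM⟩ : ∃ M : ℝ, 0 ≤ M ∧ ∀ z ∈ Metric.sphere (0 : E × E) 1,
      ‖z.1 - z.2‖ ^ p ≤ ε * (‖z.1‖ ^ p + ‖z.2‖ ^ p) +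
        M * ((‖z.1‖ ^ p + ‖z.2‖ ^ p) / 2 - ‖(1 / 2 : ℝ) • (z.1 + z.2)‖ ^ p) := by
    have c1 : Continuous fun z : E × E => ‖z.1 - z.2‖ ^ p :=
      (continuous_fst.sub continuous_snd).norm.rpow_const fun _ => Or.inr hp0.le
    have c2 : Continuous fun z : E × E => ‖z.1‖ ^ p + ‖z.2‖ ^ p :=
      (continuous_fst.norm.rpow_const fun _ => Or.inr hp0.le).add
        (continuous_snd.norm.rpow_const fun _ => Or.inr hp0.le)
    have c3 : Continuous fun z : E × E => ‖(1 / 2 : ℝ) • (z.1 + z.2)‖ ^ p :=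
      ((continuous_fst.add continuous_snd).const_smul _).norm.rpow_const fun _ => Or.inr hp0.le
    set T : Set (E × E) := Metric.sphere 0 1 ∩ {z | ε * (‖z.1‖ ^ p + ‖z.2‖ ^ p) ≤ ‖z.1 - z.2‖ ^ p}
    have hTc : IsCompact T := (isCompact_sphere (0 : E × E) 1).inter_right
      (isClosed_le (continuous_const.mul c2) c1)
    rcases T.eq_empty_or_nonempty with hTe | hTn
    · refine ⟨0, le_rfl, fun z hz => ?_⟩
      by_contra hcon
      rw [zero_mul, add_zero, not_le] at hcon
      have : z ∈ T := ⟨hz, hcon.le⟩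
      rw [hTe] at this
      exact this
    · obtain ⟨z₀, hz₀, hmin⟩ := hTc.exists_isMinOn hTn ((c2.div_const 2).sub c3).continuousOn
      set δ := (‖z₀.1‖ ^ p + ‖z₀.2‖ ^ p) / 2 - ‖(1 / 2 : ℝ) • (z₀.1 + z₀.2)‖ ^ p
      have hδ0 : 0 < δ := by
        refine sub_pos.2 (norm_rpow_midpoint_lt hp fun h => ?_)
        have h1 := hz₀.2
        rw [mem_ofPred_eq, h, sub_self, norm_zero, Real.zero_rpow hp0.ne'] at h1
        have h2 : ‖z₀.2‖ ^ p = 0 := le_antisymm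
          (by nlinarith [Real.rpow_nonneg (norm_nonneg z₀.2) p])
          (Real.rpow_nonneg (norm_nonneg _) p)
        have h3 : z₀.2 = 0 := by
          rwa [Real.rpow_eq_zero (norm_nonneg _) hp0.ne', norm_eq_zero] at h2
        have h4 : z₀ = 0 := Prod.ext (h.trans h3) h3
        have h5 := hz₀.1
        rw [h4, mem_sphere_zero_iff_norm, norm_zero] at h5
        exact zero_ne_one h5
      refine ⟨2 ^ p / δ, by positivity, fun z hz => ?_⟩
      have hε0 : 0 ≤ ε * (‖z.1‖ ^ p + ‖z.2‖ ^ p) := by positivity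
      by_cases hzT : z ∈ T
      · have h1 : ‖z.1 - z.2‖ ^ p ≤ 2 ^ p := by
          refine Real.rpow_le_rpow (norm_nonneg _) ?_ hp0.le
          have hz1 := mem_sphere_zero_iff_norm.1 hz
          have := norm_fst_le z
          have := norm_snd_le z
          exact (norm_sub_le _ _).trans (by linarith)
        have h2 := hmin hzT
        have h3 : 2 ^ p = 2 ^ p / δ * δ := by field_simp
        have h4 : 2 ^ p / δ * δ ≤
            2 ^ p / δ * ((‖z.1‖ ^ p + ‖z.2‖ ^ p) / 2 - ‖(1 / 2 : ℝ) • (z.1 + z.2)‖ ^ p) :=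
          mul_le_mul_of_nonneg_left h2 (by positivity)
        linarith
      · have h1 : ‖z.1 - z.2‖ ^ p < ε * (‖z.1‖ ^ p + ‖z.2‖ ^ p) := by
          by_contra hcon
          exact hzT ⟨hz, not_lt.1 hcon⟩
        have h2 : 0 ≤ 2 ^ p / δ *
            ((‖z.1‖ ^ p + ‖z.2‖ ^ p) / 2 - ‖(1 / 2 : ℝ) • (z.1 + z.2)‖ ^ p) :=
          mul_nonneg (by positivity) (hgap0 _ _)
        linarith
  refine ⟨M, hM0, fun a b => ?_⟩
  rcases eq_or_ne (a, b) 0 with h0 | h0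
  · obtain ⟨rfl, rfl⟩ := Prod.mk_eq_zero.1 h0
    simp [Real.zero_rpow hp0.ne']
  · set t := ‖(a, b)‖
    have ht0 : 0 < t := norm_pos_iff.2 h0
    have htp : 0 < t ^ p := Real.rpow_pos_of_pos ht0 p
    have h1 := hM (t⁻¹ • (a, b)) (by
      rw [mem_sphere_zero_iff_norm, norm_smul, norm_inv, Real.norm_eq_abs, abs_of_pos ht0]
      exact inv_mul_cancel₀ ht0.ne')
    have hs : ∀ x : E, ‖t⁻¹ • x‖ ^ p = (t ^ p)⁻¹ * ‖x‖ ^ p := by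
      intro x
      rw [norm_smul, norm_inv, Real.norm_eq_abs, abs_of_pos ht0,
        Real.mul_rpow (by positivity) (norm_nonneg _), Real.inv_rpow ht0.le]
    simp only [Prod.smul_fst, Prod.smul_snd, ← smul_sub, ← smul_add] at h1
    rw [smul_comm, hs, hs, hs, hs] at h1
    have h2 := mul_le_mul_of_nonneg_left h1 htp.le
    have h3 : t ^ p * (t ^ p)⁻¹ = 1 := mul_inv_cancel₀ htp.ne'
    calc ‖a - b‖ ^ p = t ^ p * ((t ^ p)⁻¹ * ‖a - b‖ ^ p) := by rw [← mul_assoc, h3, one_mul]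
      _ ≤ _ := h2
      _ = (t ^ p * (t ^ p)⁻¹) * (ε * (‖a‖ ^ p + ‖b‖ ^ p) +
          M * ((‖a‖ ^ p + ‖b‖ ^ p) / 2 - ‖(1 / 2 : ℝ) • (a + b)‖ ^ p)) := by ring
      _ = _ := by rw [h3, one_mul]

end UniformConvexity

section Minimization

variable {α E : Type*} [MeasurableSpace α] {μ : Measure α} [NormedAddCommGroup E]

theorem MeasureTheory.MemLp.integrable_norm_rpow_ofReal (hp : 0 < p) {u : α → E}
    (hu : MemLp u (ENNReal.ofReal p) μ) : Integrable (fun x => ‖u x‖ ^ p) μ := by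
  have := hu.integrable_norm_rpow (by simpa using hp) ENNReal.ofReal_ne_top
  rwa [ENNReal.toReal_ofReal hp.le] at this

theorem MeasureTheory.Lp.norm_rpow_eq_integral (hp : 0 < p) (u : Lp E (ENNReal.ofReal p) μ) :
    ‖u‖ ^ p = ∫ x, ‖u x‖ ^ p ∂μ := by
  rw [Lp.norm_def, (Lp.memLp u).eLpNorm_eq_integral_rpow_norm (by simpa using hp)
    ENNReal.ofReal_ne_top, ENNReal.toReal_ofReal hp.le, ENNReal.toReal_ofReal (by positivity),
    ← Real.rpow_mul (by positivity), inv_mul_cancel₀ hp.ne', Real.rpow_one]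

/-- The convexity gap of `‖·‖ ^ p` controls distances in `L^p`. -/
theorem exists_norm_sub_rpow_le_Lp [InnerProductSpace ℝ E] [FiniteDimensional ℝ E]
    (hp : 1 < p) {ε : ℝ} (hε : 0 < ε) :
    ∃ M : ℝ, 0 ≤ M ∧ ∀ u v : Lp E (ENNReal.ofReal p) μ,
      ‖u - v‖ ^ p ≤ ε * (‖u‖ ^ p + ‖v‖ ^ p) +
        M * ((‖u‖ ^ p + ‖v‖ ^ p) / 2 - ‖(1 / 2 : ℝ) • (u + v)‖ ^ p) := by
  obtain ⟨M, hM0, hM⟩ := exists_norm_sub_rpow_le (E := E) hp hε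
  refine ⟨M, hM0, fun u v => ?_⟩
  have hp0 : 0 < p := by linarith
  have iu := (Lp.memLp u).integrable_norm_rpow_ofReal hp0
  have iv := (Lp.memLp v).integrable_norm_rpow_ofReal hp0
  have isub := (Lp.memLp (u - v)).integrable_norm_rpow_ofReal hp0
  have imid := (Lp.memLp ((1 / 2 : ℝ) • (u + v))).integrable_norm_rpow_ofReal hp0
  have ia : Integrable (fun x => ‖u x‖ ^ p + ‖v x‖ ^ p) μ := iu.add iv
  have ib : Integrable (fun x => (‖u x‖ ^ p + ‖v x‖ ^ p) / 2 -
      ‖((1 / 2 : ℝ) • (u + v) : Lp E (ENNReal.ofReal p) μ) x‖ ^ p) μ := (ia.div_const 2).sub imid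
  simp only [Lp.norm_rpow_eq_integral hp0]
  have e : ε * ((∫ x, ‖u x‖ ^ p ∂μ) + ∫ x, ‖v x‖ ^ p ∂μ) +
      M * (((∫ x, ‖u x‖ ^ p ∂μ) + ∫ x, ‖v x‖ ^ p ∂μ) / 2 -
        ∫ x, ‖((1 / 2 : ℝ) • (u + v) : Lp E (ENNReal.ofReal p) μ) x‖ ^ p ∂μ) =
      ∫ x, (ε * (‖u x‖ ^ p + ‖v x‖ ^ p) + M * ((‖u x‖ ^ p + ‖v x‖ ^ p) / 2 -
        ‖((1 / 2 : ℝ) • (u + v) : Lp E (ENNReal.ofReal p) μ) x‖ ^ p)) ∂μ := by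
    rw [integral_add (ia.const_mul ε) (ib.const_mul M),
      integral_const_mul, integral_const_mul, integral_sub (ia.div_const 2) imid,
      integral_div, integral_add iu iv]
  rw [e]
  refine integral_mono_ae isub ((ia.const_mul ε).add (ib.const_mul M)) ?_
  filter_upwards [Lp.coeFn_sub u v, Lp.coeFn_smul (1 / 2 : ℝ) (u + v), Lp.coeFn_add u v]
    with x h1 h2 h3
  simp only [h1, h2, Pi.smul_apply, h3, Pi.add_apply, Pi.sub_apply]
  exact hM (u x) (v x)

/-- The energy `(1/p) ‖G‖ ^ p - ℓ G` attains its minimum on a closed subspace of `L^p`: by the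
uniform convexity of `‖·‖ ^ p`, minimizing sequences are Cauchy. -/
theorem exists_min_energy [InnerProductSpace ℝ E] [FiniteDimensional ℝ E]
    [Fact (1 ≤ ENNReal.ofReal p)] (hpq : p.HolderConjugate q)
    (R : Submodule ℝ (Lp E (ENNReal.ofReal p) μ))
    (hR : IsClosed (R : Set (Lp E (ENNReal.ofReal p) μ)))
    (ℓ : Lp E (ENNReal.ofReal p) μ →L[ℝ] ℝ) :
    ∃ G ∈ R, ∀ H ∈ R, 1 / p * ‖G‖ ^ p - ℓ G ≤ 1 / p * ‖H‖ ^ p - ℓ H := by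
  have hp0 := hpq.pos
  set J : Lp E (ENNReal.ofReal p) μ → ℝ := fun G => 1 / p * ‖G‖ ^ p - ℓ G with hJ
  have hJc : Continuous J := by
    have : Continuous fun G : Lp E (ENNReal.ofReal p) μ => ‖G‖ ^ p :=
      continuous_norm.rpow_const fun _ => Or.inr hp0.le
    exact (continuous_const.mul this).sub ℓ.continuous
  set c := (2 * ‖ℓ‖) ^ q / q
  -- coercivity: Young's inequality for `(‖G‖ / 2) * (2 ‖ℓ‖)` absorbs `ℓ G` in half of the energy
  have hcoer : ∀ G, ‖G‖ ^ p / (2 * p) - c ≤ J G := by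
    intro G
    have h1 : ℓ G ≤ ‖ℓ‖ * ‖G‖ := (le_abs_self _).trans (ℓ.le_opNorm G)
    have h2 := Real.young_inequality_of_nonneg (a := ‖G‖ / 2) (b := 2 * ‖ℓ‖) (by positivity)
      (by positivity) hpq
    have h3 : (‖G‖ / 2) ^ p ≤ ‖G‖ ^ p / 2 := by
      rw [Real.div_rpow (norm_nonneg _) zero_le_two]
      refine div_le_div_of_nonneg_left (by positivity) zero_lt_two ?_
      simpa using Real.rpow_le_rpow_of_exponent_le one_le_two hpq.lt.le
    have h4 : (‖G‖ / 2) ^ p / p ≤ ‖G‖ ^ p / 2 / p := by gcongr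
    have h5 : ‖G‖ ^ p / 2 / p = ‖G‖ ^ p / (2 * p) := by rw [div_div]
    have h6 : 1 / p * ‖G‖ ^ p = ‖G‖ ^ p / (2 * p) + ‖G‖ ^ p / (2 * p) := by field_simp; ring
    simp only [hJ]
    rw [h6]
    linarith
  have hbdd : BddBelow (J '' R) := by
    refine ⟨-c, ?_⟩
    rintro _ ⟨G, -, rfl⟩
    have : 0 ≤ ‖G‖ ^ p / (2 * p) := by positivity
    linarith [hcoer G]
  have hne : (J '' R).Nonempty := ⟨J 0, 0, R.zero_mem, rfl⟩
  set m := sInf (J '' R)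
  have hmle : ∀ G ∈ R, m ≤ J G := fun G hG => csInf_le hbdd (mem_image_of_mem J hG)
  obtain ⟨u, -, hulim, hu⟩ := exists_seq_tendsto_sInf hne hbdd
  choose G hGR hGu using hu
  have hJG : Tendsto (fun n => J (G n)) atTop (𝓝 m) := by
    simpa only [hGu] using hulim
  have hbound : ∀ᶠ n in atTop, ‖G n‖ ^ p ≤ 2 * p * (m + 1 + c) := by
    filter_upwards [hJG.eventually (gt_mem_nhds (lt_add_one m))] with n hn
    have h1 := hcoer (G n)
    have h2 : ‖G n‖ ^ p / (2 * p) ≤ m + 1 + c := by linarith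
    rw [div_le_iff₀ (by positivity)] at h2
    linarith
  set B := 2 * p * (m + 1 + c)
  have hB0 : 0 ≤ B := by
    obtain ⟨n, hn⟩ := hbound.exists
    exact le_trans (by positivity) hn
  have hcau : CauchySeq G := by
    rw [Metric.cauchySeq_iff]
    intro η hη
    have hηp : 0 < η ^ p := Real.rpow_pos_of_pos hη p
    obtain ⟨M, hM0, hM⟩ := exists_norm_sub_rpow_le_Lp (E := E) (μ := μ) (p := p) hpq.lt
      (ε := η ^ p / (4 * (B + 1))) (by positivity)
    have hsmall : ∀ᶠ n in atTop, J (G n) < m + η ^ p / (4 * (M * p + 1)) :=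
      hJG.eventually (gt_mem_nhds (by
        have : 0 < η ^ p / (4 * (M * p + 1)) := by positivity
        linarith))
    obtain ⟨N, hN⟩ := eventually_atTop.1 (hbound.and hsmall)
    refine ⟨N, fun i hi j hj => ?_⟩
    obtain ⟨bi, si⟩ := hN i hi
    obtain ⟨bj, sj⟩ := hN j hj
    have h1 := hM (G i) (G j)
    have h2 := hmle _ (R.smul_mem (1 / 2 : ℝ) (R.add_mem (hGR i) (hGR j)))
    have h3 : (‖G i‖ ^ p + ‖G j‖ ^ p) / 2 - ‖(1 / 2 : ℝ) • (G i + G j)‖ ^ p ≤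
        p * (η ^ p / (4 * (M * p + 1))) := by
      have e : (‖G i‖ ^ p + ‖G j‖ ^ p) / 2 - ‖(1 / 2 : ℝ) • (G i + G j)‖ ^ p =
          p * ((J (G i) + J (G j)) / 2 - J ((1 / 2 : ℝ) • (G i + G j))) := by
        simp only [hJ, map_smul, map_add, smul_eq_mul]
        field_simp
        ring
      rw [e]
      refine mul_le_mul_of_nonneg_left ?_ hp0.le
      linarith
    have h4 : M * ((‖G i‖ ^ p + ‖G j‖ ^ p) / 2 - ‖(1 / 2 : ℝ) • (G i + G j)‖ ^ p) ≤ η ^ p / 4 := by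
      refine (mul_le_mul_of_nonneg_left h3 hM0).trans ?_
      rw [← mul_assoc, mul_div_assoc', div_le_div_iff₀ (by positivity) (by norm_num)]
      nlinarith [mul_nonneg hM0 hp0.le]
    have h5 : η ^ p / (4 * (B + 1)) * (‖G i‖ ^ p + ‖G j‖ ^ p) ≤ η ^ p / 2 := by
      refine (mul_le_mul_of_nonneg_left (add_le_add bi bj) (by positivity)).trans ?_
      rw [div_mul_eq_mul_div, div_le_div_iff₀ (by positivity) (by norm_num)]
      nlinarith
    rw [dist_eq_norm]
    by_contra hcon
    have h6 := Real.rpow_le_rpow hη.le (not_lt.1 hcon) hp0.le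
    linarith
  obtain ⟨G₀, hG₀⟩ := cauchySeq_tendsto_of_complete hcau
  refine ⟨G₀, hR.mem_of_tendsto hG₀ (Eventually.of_forall hGR), fun H hH => ?_⟩
  have : J G₀ = m := tendsto_nhds_unique ((hJc.tendsto G₀).comp hG₀) hJG
  change J G₀ ≤ J H
  rw [this]
  exact hmle H hH

end Minimization

/-! ### Duality between potentials and admissible fields -/

theorem MeasureTheory.MemLp.integrable_inner (hpq : p.HolderConjugate q) {v G : Plane → Plane}
    (hv : MemLp v (ENNReal.ofReal q) (volume.restrict Ω))
    (hG : MemLp G (ENNReal.ofReal p) (volume.restrict Ω)) :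
    Integrable (fun x => inner ℝ (v x) (G x)) (volume.restrict Ω) := by
  have := hpq.symm.ennrealOfReal
  refine Integrable.mono' (hv.norm.integrable_mul hG.norm) (hv.1.inner hG.1)
    (Eventually.of_forall fun x => ?_)
  exact norm_inner_le_norm _ _

/-- Integration against a field of `L^q` as a functional on `L^p`. -/
theorem exists_inner_functional [Fact (1 ≤ ENNReal.ofReal p)] (hpq : p.HolderConjugate q)
    {v : Plane → Plane} (hv : MemLp v (ENNReal.ofReal q) (volume.restrict Ω)) :
    ∃ ℓ : Lp Plane (ENNReal.ofReal p) (volume.restrict Ω) →L[ℝ] ℝ,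
      ∀ G, ℓ G = ∫ x in Ω, inner ℝ (v x) (G x) := by
  have := hpq.ennrealOfReal
  have := hpq.symm.ennrealOfReal
  have : Fact (1 ≤ ENNReal.ofReal q) := ⟨by simpa using hpq.symm.lt.le⟩
  refine ⟨(innerSL ℝ : Plane →L[ℝ] Plane →L[ℝ] ℝ).lpPairing (volume.restrict Ω)
    (ENNReal.ofReal q) (ENNReal.ofReal p) (hv.toLp v), fun G => ?_⟩
  rw [ContinuousLinearMap.lpPairing_eq_integral]
  exact integral_congr_ae (hv.coeFn_toLp.mono fun x hx => by
    simp only [hx]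
    rfl)

/-- The `C¹` functions vanishing on `K` and the space `W^{1,p}_K(Ω)` give the same constraint
`-div v = f`. -/
theorem mem_admissiblePairs_iff (hΩ : IsOpen Ω) (hb : Bornology.IsBounded Ω)
    (hL : HasLipschitzBoundary Ω) (hpq : p.HolderConjugate q) {r s : ℝ≥0∞}
    (hr : IsSobolevExponent p r) (hrs : r.HolderConjugate s) {f : Plane → ℝ}
    (hf : MemLp f s (volume.restrict Ω)) {v : Plane → Plane} :
    (K, v) ∈ admissiblePairs Ω q f ↔ K ∈ closedConnected Ω ∧
      MemLp v (ENNReal.ofReal q) (volume.restrict Ω) ∧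
      ∀ u G, MemW1pVanishing Ω K p u G → ∫ x in Ω, inner ℝ (v x) (G x) = ∫ x in Ω, u x * f x := by
  have : Fact (1 ≤ ENNReal.ofReal p) := ⟨by simpa using hpq.lt.le⟩
  constructor
  · rintro ⟨hK, hv, h⟩
    refine ⟨hK, hv, fun u G huG => ?_⟩
    obtain ⟨hu, hG, hmem⟩ := (memW1pVanishing_iff hpq).1 huG
    obtain ⟨ℓ, hℓ⟩ := exists_inner_functional (p := p) hpq hv
    obtain ⟨C, hC⟩ := hL.exists_load_bound (K := K) hΩ hb hpq hr hrs hf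
    obtain ⟨w, hw, hlim⟩ := mem_closure_iff_seq_limit.1
      (by simpa [vanishingGraph, ← SetLike.mem_coe, Submodule.topologicalClosure_coe] using hmem)
    have hwV : ∀ n, w n ∈ vanishingGraph Ω K p := fun n =>
      (testGraph Ω K p).le_topologicalClosure (hw n)
    have hw1 : ∀ n, ℓ (w n).2 = ∫ x in Ω, (w n).1 x * f x := by
      intro n
      obtain ⟨φ, h1, -, h3, h4, h5⟩ := hw n
      have e := h φ (h1.of_le (by norm_num)) fun x hx => image_eq_zero_of_notMem_tsupport
        fun hx' => Set.disjoint_left.1 h3 hx' hx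
      rw [hℓ, integral_congr_ae (h4.mono fun x hx => by simp only [hx] :
          (fun x => (w n).1 x * f x) =ᵐ[volume.restrict Ω] fun x => φ x * f x), ← e]
      exact integral_congr_ae (h5.mono fun x hx => by simp only [hx])
    have lim1 : Tendsto (fun n => ℓ (w n).2) atTop (𝓝 (ℓ (hG.toLp G))) :=
      ((ℓ.continuous.comp continuous_snd).tendsto _).comp hlim
    have lim2 : Tendsto (fun n => ∫ x in Ω, (w n).1 x * f x) atTop
        (𝓝 (∫ x in Ω, hu.toLp u x * f x)) := by
      rw [tendsto_iff_norm_sub_tendsto_zero]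
      have hz : Tendsto (fun n => C * ‖w n - (hu.toLp u, hG.toLp G)‖) atTop (𝓝 0) := by
        simpa using (tendsto_iff_norm_sub_tendsto_zero.1 hlim).const_mul C
      refine squeeze_zero (fun _ => norm_nonneg _) (fun n => ?_) hz
      have h1 := (hC _ (Submodule.sub_mem _ (hwV n) hmem)).2
      have h2 : ∫ x in Ω, (w n - (hu.toLp u, hG.toLp G)).1 x * f x =
          (∫ x in Ω, (w n).1 x * f x) - ∫ x in Ω, hu.toLp u x * f x := by
        rw [← integral_sub (hC _ (hwV n)).1 (hC _ hmem).1]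
        refine integral_congr_ae ?_
        filter_upwards [Lp.coeFn_sub (w n).1 (hu.toLp u)] with x hx
        rw [Prod.fst_sub, hx, Pi.sub_apply, sub_mul]
      rwa [h2] at h1
    simp_rw [hw1] at lim1
    have e := tendsto_nhds_unique lim1 lim2
    rw [hℓ] at e
    rw [integral_congr_ae (hG.coeFn_toLp.mono fun x hx => by simp only [hx] :
        (fun x => inner ℝ (v x) (hG.toLp G x)) =ᵐ[volume.restrict Ω] fun x => inner ℝ (v x) (G x)),
      integral_congr_ae (hu.coeFn_toLp.mono fun x hx => by simp only [hx] :
        (fun x => hu.toLp u x * f x) =ᵐ[volume.restrict Ω] fun x => u x * f x)] at e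
    exact e
  · rintro ⟨hK, hv, h⟩
    exact ⟨hK, hv, fun ψ hψ hz => h ψ (gradient ψ)
      (memW1pVanishing_of_contDiff hΩ hb hK.2.1 hpq hψ hz)⟩

/-- Integrability of `u f` on `W^{1,p}_K(Ω)`: without it, the energy would be a Bochner integral of
a non-integrable function, with the meaningless value `0`. -/
theorem MemW1pVanishing.integrable_mul_load (hΩ : IsOpen Ω) (hb : Bornology.IsBounded Ω)
    (hL : HasLipschitzBoundary Ω) (hpq : p.HolderConjugate q) {r s : ℝ≥0∞}
    (hr : IsSobolevExponent p r) (hrs : r.HolderConjugate s) {f : Plane → ℝ}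
    (hf : MemLp f s (volume.restrict Ω)) {u : Plane → ℝ} {G : Plane → Plane}
    (h : MemW1pVanishing Ω K p u G) : IntegrableOn (fun x => u x * f x) Ω := by
  have : Fact (1 ≤ ENNReal.ofReal p) := ⟨by simpa using hpq.lt.le⟩
  obtain ⟨hu, hG, hmem⟩ := (memW1pVanishing_iff hpq).1 h
  obtain ⟨C, hC⟩ := hL.exists_load_bound (K := K) hΩ hb hpq hr hrs hf
  exact (hC _ hmem).1.congr (hu.coeFn_toLp.mono fun x hx => by simp only [hx])

theorem dirichletEnergy_eq (hp : 0 < p) {f u : Plane → ℝ} {G : Plane → Plane}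
    (h : MemW1p Ω p u G) (hi : IntegrableOn (fun x => u x * f x) Ω) :
    dirichletEnergy Ω p f u G = 1 / p * (∫ x in Ω, ‖G x‖ ^ p) - ∫ x in Ω, u x * f x := by
  rw [dirichletEnergy, integral_sub ((h.2.1.integrable_norm_rpow_ofReal hp).const_mul _) hi,
    integral_const_mul]

/-- If `-div v = f` has a solution in `L^q` then the energy is `(1/p) ∫ |∇u| ^ p - ∫ v · ∇u`, which
depends on `∇u` only and attains its minimum on the closed space of gradients. -/
theorem exists_isPotential (hΩ : IsOpen Ω) (hb : Bornology.IsBounded Ω)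
    (hL : HasLipschitzBoundary Ω) (hpq : p.HolderConjugate q) {r s : ℝ≥0∞}
    (hr : IsSobolevExponent p r) (hrs : r.HolderConjugate s) {f : Plane → ℝ}
    (hf : MemLp f s (volume.restrict Ω)) {v : Plane → Plane}
    (hKv : (K, v) ∈ admissiblePairs Ω q f) : ∃ u G, IsPotential Ω K p f u G := by
  have : Fact (1 ≤ ENNReal.ofReal p) := ⟨by simpa using hpq.lt.le⟩
  obtain ⟨hK, hv, h⟩ := (mem_admissiblePairs_iff hΩ hb hL hpq hr hrs hf).1 hKv
  obtain ⟨ℓ, hℓ⟩ := exists_inner_functional (p := p) hpq hv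
  obtain ⟨_, ⟨z, hz, rfl⟩, hmin⟩ := exists_min_energy hpq _
    (hL.isClosed_range_gradient (K := K) hΩ hb hpq) ℓ
  have hzm := memW1pVanishing_of_mem_vanishingGraph hpq hz
  refine ⟨z.1, z.2, hzm, fun w H hwH => ?_⟩
  obtain ⟨hw, hH, hmem⟩ := (memW1pVanishing_iff hpq).1 hwH
  have key : ∀ {u G}, MemW1pVanishing Ω K p u G → dirichletEnergy Ω p f u G =
      1 / p * (∫ x in Ω, ‖G x‖ ^ p) - ∫ x in Ω, inner ℝ (v x) (G x) := fun hu => by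
    rw [h _ _ hu]
    exact dirichletEnergy_eq hpq.pos hu.1 (hu.integrable_mul_load hΩ hb hL hpq hr hrs hf)
  have hle := hmin (hH.toLp H) ⟨_, hmem, rfl⟩
  rw [hℓ, hℓ, Lp.norm_rpow_eq_integral hpq.pos, Lp.norm_rpow_eq_integral hpq.pos] at hle
  rw [key hzm, key hwH]
  refine hle.trans (le_of_eq ?_)
  congr 1
  · congr 1
    exact integral_congr_ae (hH.coeFn_toLp.mono fun x hx => by simp only [hx])
  · exact integral_congr_ae (hH.coeFn_toLp.mono fun x hx => by simp only [hx])

/-- The flux `|G| ^ (p - 2) G` of a gradient field `G`. -/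
noncomputable def flux (p : ℝ) (G : Plane → Plane) : Plane → Plane :=
  fun x => ‖G x‖ ^ (p - 2) • G x

theorem norm_flux (hp : 1 < p) (G : Plane → Plane) (x : Plane) :
    ‖flux p G x‖ = ‖G x‖ ^ (p - 1) := by
  rw [flux, norm_smul, Real.norm_of_nonneg (by positivity)]
  rcases (norm_nonneg (G x)).eq_or_lt with h | h
  · rw [← h, mul_zero, Real.zero_rpow (by linarith)]
  · rw [← Real.rpow_add_one h.ne']; congr 1; ring

theorem norm_flux_rpow (hpq : p.HolderConjugate q) (G : Plane → Plane) (x : Plane) :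
    ‖flux p G x‖ ^ q = ‖G x‖ ^ p := by
  rw [norm_flux hpq.lt, ← Real.rpow_mul (norm_nonneg _), hpq.sub_one_mul_conj]

theorem inner_flux (hp : 1 < p) (G : Plane → Plane) (x : Plane) :
    inner ℝ (flux p G x) (G x) = ‖G x‖ ^ p := by
  rw [flux, real_inner_smul_left, real_inner_self_eq_norm_sq]
  rcases (norm_nonneg (G x)).eq_or_lt with h | h
  · rw [← h, Real.zero_rpow (by linarith : p ≠ 0)]; simp
  · rw [← Real.rpow_natCast, ← Real.rpow_add h]; congr 1; push_cast; ring

theorem memLp_flux (hpq : p.HolderConjugate q) {G : Plane → Plane}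
    (hG : MemLp G (ENNReal.ofReal p) (volume.restrict Ω)) :
    MemLp (flux p G) (ENNReal.ofReal q) (volume.restrict Ω) := by
  have hm : AEStronglyMeasurable (flux p G) (volume.restrict Ω) :=
    (hG.1.norm.aemeasurable.pow_const (p - 2)).aestronglyMeasurable.smul hG.1
  rw [← integrable_norm_rpow_iff hm (by simpa using hpq.symm.pos) ENNReal.ofReal_ne_top,
    ENNReal.toReal_ofReal hpq.symm.nonneg]
  simp_rw [norm_flux_rpow hpq]
  exact hG.integrable_norm_rpow_ofReal hpq.pos

/-- The derivative of `t ↦ ∫ ‖G + t H‖ ^ p` at `t = 0`. -/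
theorem hasDerivAt_integral_norm_rpow (hpq : p.HolderConjugate q) {G H : Plane → Plane}
    (hG : MemLp G (ENNReal.ofReal p) (volume.restrict Ω))
    (hH : MemLp H (ENNReal.ofReal p) (volume.restrict Ω)) :
    HasDerivAt (fun t : ℝ => ∫ x in Ω, ‖G x + t • H x‖ ^ p)
      (∫ x in Ω, p * inner ℝ (flux p G x) (H x)) 0 := by
  have hp := hpq.lt
  have hp0 := hpq.pos
  have hder : ∀ x (t : ℝ), HasDerivAt (fun t : ℝ => ‖G x + t • H x‖ ^ p)
      (p * inner ℝ (flux p (fun x => G x + t • H x) x) (H x)) t := by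
    intro x t
    have h1 : HasDerivAt (fun t : ℝ => G x + t • H x) (H x) t := by
      simpa using ((hasDerivAt_id t).smul_const (H x)).const_add (G x)
    refine ((hasFDerivAt_norm_rpow (G x + t • H x) hp).comp_hasDerivAt t h1).congr_deriv ?_
    have e : inner ℝ (flux p (fun x => G x + t • H x) x) (H x) =
        ‖G x + t • H x‖ ^ (p - 2) * inner ℝ (G x + t • H x) (H x) := real_inner_smul_left _ _ _
    rw [e, ← mul_assoc]
    rfl
  have hmem : ∀ t : ℝ, MemLp (fun x => G x + t • H x) (ENNReal.ofReal p) (volume.restrict Ω) :=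
    fun t => hG.add (hH.const_smul t)
  have hbint : Integrable (fun x => p * (‖G x‖ + ‖H x‖) ^ p) (volume.restrict Ω) := by
    refine Integrable.const_mul ?_ p
    have := (hG.norm.add hH.norm).integrable_norm_rpow_ofReal hp0
    refine this.congr (Eventually.of_forall fun x => ?_)
    simp only [Pi.add_apply]
    rw [Real.norm_of_nonneg (by positivity)]
  have := hasDerivAt_integral_of_dominated_loc_of_deriv_le (μ := volume.restrict Ω)
    (F := fun t x => ‖G x + t • H x‖ ^ p)
    (F' := fun t x => p * inner ℝ (flux p (fun x => G x + t • H x) x) (H x))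
    (x₀ := (0 : ℝ)) (s := Metric.ball 0 1) (bound := fun x => p * (‖G x‖ + ‖H x‖) ^ p)
    (Metric.ball_mem_nhds 0 one_pos)
    (Eventually.of_forall fun t => ((hmem t).integrable_norm_rpow_ofReal hp0).1)
    ((hmem 0).integrable_norm_rpow_ofReal hp0)
    (((memLp_flux hpq (hmem 0)).integrable_inner hpq hH).const_mul p).1
    (Eventually.of_forall fun x t ht => ?_) hbint
    (Eventually.of_forall fun x t _ => hder x t)
  · simpa only [zero_smul, add_zero, flux] using this.2
  · have ht1 : |t| ≤ 1 := by simpa using (mem_ball_zero_iff.1 ht).le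
    have h1 : ‖G x + t • H x‖ ≤ ‖G x‖ + ‖H x‖ := by
      refine (norm_add_le _ _).trans (add_le_add le_rfl ?_)
      rw [norm_smul]
      exact mul_le_of_le_one_left (norm_nonneg _) ht1
    have h2 : ‖H x‖ ≤ ‖G x‖ + ‖H x‖ := by linarith [norm_nonneg (G x)]
    have h3 : 0 ≤ ‖G x‖ + ‖H x‖ := by positivity
    rw [norm_mul, Real.norm_of_nonneg hp0.le]
    refine mul_le_mul_of_nonneg_left ?_ hp0.le
    refine (norm_inner_le_norm _ _).trans ?_
    rw [norm_flux hp]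
    calc ‖G x + t • H x‖ ^ (p - 1) * ‖H x‖
        ≤ (‖G x‖ + ‖H x‖) ^ (p - 1) * (‖G x‖ + ‖H x‖) ^ (1 : ℝ) := by
          rw [Real.rpow_one]
          exact mul_le_mul (Real.rpow_le_rpow (norm_nonneg _) h1 (by linarith)) h2 (norm_nonneg _)
            (by positivity)
      _ = (‖G x‖ + ‖H x‖) ^ p := by
          rw [← Real.rpow_add_of_nonneg h3 (by linarith) zero_le_one, sub_add_cancel]

theorem MemW1pVanishing.add_smul (hpq : p.HolderConjugate q) {u w : Plane → ℝ}
    {G H : Plane → Plane} (hu : MemW1pVanishing Ω K p u G) (hw : MemW1pVanishing Ω K p w H)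
    (t : ℝ) : MemW1pVanishing Ω K p (fun x => u x + t * w x) (fun x => G x + t • H x) := by
  have : Fact (1 ≤ ENNReal.ofReal p) := ⟨by simpa using hpq.lt.le⟩
  obtain ⟨u1, u2, u3⟩ := (memW1pVanishing_iff hpq).1 hu
  obtain ⟨w1, w2, w3⟩ := (memW1pVanishing_iff hpq).1 hw
  exact (memW1pVanishing_iff hpq).2 ⟨u1.add (w1.const_smul t), u2.add (w2.const_smul t),
    Submodule.add_mem _ u3 (Submodule.smul_mem _ t w3)⟩

/-- The Euler–Lagrange equation: the flux of the gradient of a potential is an admissible field. -/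
theorem IsPotential.flux_mem_admissiblePairs (hΩ : IsOpen Ω) (hb : Bornology.IsBounded Ω)
    (hL : HasLipschitzBoundary Ω) (hpq : p.HolderConjugate q) {r s : ℝ≥0∞}
    (hr : IsSobolevExponent p r) (hrs : r.HolderConjugate s) {f : Plane → ℝ}
    (hf : MemLp f s (volume.restrict Ω)) (hK : K ∈ closedConnected Ω) {u : Plane → ℝ}
    {G : Plane → Plane} (hu : IsPotential Ω K p f u G) :
    (K, flux p G) ∈ admissiblePairs Ω q f := by
  have hp0 := hpq.pos
  refine (mem_admissiblePairs_iff hΩ hb hL hpq hr hrs hf).2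
    ⟨hK, memLp_flux hpq hu.1.1.2.1, fun w H hw => ?_⟩
  have iu := hu.1.integrable_mul_load hΩ hb hL hpq hr hrs hf
  have iw := hw.integrable_mul_load hΩ hb hL hpq hr hrs hf
  have hE : ∀ t : ℝ, dirichletEnergy Ω p f (fun x => u x + t * w x) (fun x => G x + t • H x) =
      1 / p * (∫ x in Ω, ‖G x + t • H x‖ ^ p) -
        ((∫ x in Ω, u x * f x) + t * ∫ x in Ω, w x * f x) := by
    intro t
    have hm := hu.1.add_smul hpq hw t
    rw [dirichletEnergy_eq hp0 hm.1 (hm.integrable_mul_load hΩ hb hL hpq hr hrs hf),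
      ← integral_const_mul t, ← integral_add iu (iw.const_mul t)]
    congr 2
    ext x
    ring
  have hd : HasDerivAt (fun t : ℝ => 1 / p * (∫ x in Ω, ‖G x + t • H x‖ ^ p) -
      ((∫ x in Ω, u x * f x) + t * ∫ x in Ω, w x * f x))
      (1 / p * (∫ x in Ω, p * inner ℝ (flux p G x) (H x)) - 1 * ∫ x in Ω, w x * f x) 0 :=
    ((hasDerivAt_integral_norm_rpow hpq hu.1.1.2.1 hw.1.2.1).const_mul (1 / p)).sub
      (((hasDerivAt_id' (0 : ℝ)).mul_const _).const_add _)
  have hmin : IsLocalMin (fun t : ℝ => 1 / p * (∫ x in Ω, ‖G x + t • H x‖ ^ p) -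
      ((∫ x in Ω, u x * f x) + t * ∫ x in Ω, w x * f x)) 0 := by
    refine Eventually.of_forall fun t => ?_
    simp only
    rw [← hE, ← hE]
    simpa using hu.2 _ _ (hu.1.add_smul hpq hw t)
  have h0 := hmin.hasDerivAt_eq_zero hd
  rw [integral_const_mul, ← mul_assoc, one_div_mul_cancel hp0.ne', one_mul, one_mul] at h0
  exact sub_eq_zero.1 h0

/-- The compliance of a potential is the least value of `(1/q) ∫ |v| ^ q` among admissible fields:
it is attained by the flux, and it is a lower bound by Young's inequality. -/
theorem IsPotential.isLeast_complianceTerm (hΩ : IsOpen Ω) (hb : Bornology.IsBounded Ω)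
    (hL : HasLipschitzBoundary Ω) (hpq : p.HolderConjugate q) {r s : ℝ≥0∞}
    (hr : IsSobolevExponent p r) (hrs : r.HolderConjugate s) {f : Plane → ℝ}
    (hf : MemLp f s (volume.restrict Ω)) (hK : K ∈ closedConnected Ω) {u : Plane → ℝ}
    {G : Plane → Plane} (hu : IsPotential Ω K p f u G) :
    IsLeast {c : ℝ | ∃ v, (K, v) ∈ admissiblePairs Ω q f ∧ c = fieldTerm Ω q v}
      (complianceTerm Ω p f u) := by
  have hadm := hu.flux_mem_admissiblePairs hΩ hb hL hpq hr hrs hf hK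
  have hp0 := hpq.pos
  have hconj : (p - 1) / p = 1 / q := by
    rw [hpq.conjugate_eq]
    have : p - 1 ≠ 0 := by linarith [hpq.lt]
    field_simp
  have hload : ∫ x in Ω, u x * f x = ∫ x in Ω, ‖G x‖ ^ p := by
    rw [← ((mem_admissiblePairs_iff hΩ hb hL hpq hr hrs hf).1 hadm).2.2 u G hu.1]
    simp_rw [inner_flux hpq.lt]
  refine ⟨⟨flux p G, hadm, ?_⟩, ?_⟩
  · rw [complianceTerm, fieldTerm, hload, hconj]
    simp_rw [norm_flux_rpow hpq]
  · rintro _ ⟨v, hv, rfl⟩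
    obtain ⟨-, hvm, hve⟩ := (mem_admissiblePairs_iff hΩ hb hL hpq hr hrs hf).1 hv
    have iG := hu.1.1.2.1.integrable_norm_rpow_ofReal hp0
    have iv := hvm.integrable_norm_rpow_ofReal hpq.symm.pos
    have hyoung : ∫ x in Ω, inner ℝ (v x) (G x) ≤
        1 / p * (∫ x in Ω, ‖G x‖ ^ p) + 1 / q * ∫ x in Ω, ‖v x‖ ^ q := by
      rw [← integral_const_mul, ← integral_const_mul,
        ← integral_add (iG.const_mul _) (iv.const_mul _)]
      refine integral_mono (hvm.integrable_inner hpq hu.1.1.2.1)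
        ((iG.const_mul _).add (iv.const_mul _)) fun x => ?_
      refine (real_inner_le_norm _ _).trans ?_
      rw [mul_comm ‖v x‖]
      refine (Real.young_inequality_of_nonneg (norm_nonneg _) (norm_nonneg _) hpq).trans
        (le_of_eq ?_)
      ring
    rw [hve u G hu.1, hload] at hyoung
    rw [complianceTerm, fieldTerm, hload]
    have : (p - 1) / p = 1 - 1 / p := by field_simp
    rw [this]
    linarith

theorem mainTheorem6 (Ω : Set Plane) (hΩ_open : IsOpen Ω) (hΩ_bdd : Bornology.IsBounded Ω)
    (hΩ_lip : HasLipschitzBoundary Ω)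
    (p q : ℝ) (hpq : p.HolderConjugate q) (Λ : ℝ) (hΛ : 0 < Λ)
    (r s : ℝ≥0∞) (hr : IsSobolevExponent p r) (hrs : r.HolderConjugate s)
    (f : Plane → ℝ) (hf : MemLp f s (volume.restrict Ω)) :
    -- equality of the two infima
    sInf (complianceValues Ω p Λ f) = sInf (fieldValues Ω q Λ f) ∧
    -- the two problems have the same optimal sets
    (∀ K : Set Plane, SolvesCompliance Ω p Λ f K ↔ ∃ v, SolvesMinMin Ω q Λ f K v) ∧
    -- the duality behind it, for each fixed set
    (∀ K ∈ closedConnected Ω,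
      ((∃ u G, IsPotential Ω K p f u G) ↔ ∃ v, (K, v) ∈ admissiblePairs Ω q f) ∧
      ∀ u G, IsPotential Ω K p f u G →
        IsLeast {c : ℝ | ∃ v, (K, v) ∈ admissiblePairs Ω q f ∧ c = fieldTerm Ω q v}
          (complianceTerm Ω p f u)) := by
  have hleast : ∀ K ∈ closedConnected Ω, ∀ u G, IsPotential Ω K p f u G →
      IsLeast {c : ℝ | ∃ v, (K, v) ∈ admissiblePairs Ω q f ∧ c = fieldTerm Ω q v}
        (complianceTerm Ω p f u) := fun K hK u G hu =>
    hu.isLeast_complianceTerm hΩ_open hΩ_bdd hΩ_lip hpq hr hrs hf hK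
  have hpot : ∀ K v, (K, v) ∈ admissiblePairs Ω q f → ∃ u G, IsPotential Ω K p f u G :=
    fun K v hv => exists_isPotential hΩ_open hΩ_bdd hΩ_lip hpq hr hrs hf hv
  have hsub : complianceValues Ω p Λ f ⊆ fieldValues Ω q Λ f := by
    rintro _ ⟨K, hK, u, G, hu, rfl⟩
    obtain ⟨v, hv, h⟩ := (hleast K hK u G hu).1
    exact ⟨(K, v), hv, by rw [h]⟩
  have hle : ∀ K v, (K, v) ∈ admissiblePairs Ω q f → ∃ u G, IsPotential Ω K p f u G ∧
      (complianceTerm Ω p f u : EReal) + lengthPenalty Λ K ≤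
        (fieldTerm Ω q v : EReal) + lengthPenalty Λ K := by
    intro K v hv
    obtain ⟨u, G, hu⟩ := hpot K v hv
    exact ⟨u, G, hu, add_le_add_left
      (EReal.coe_le_coe_iff.2 ((hleast K hv.1 u G hu).2 ⟨v, hv, rfl⟩)) _⟩
  refine ⟨le_antisymm (le_sInf ?_) (sInf_le_sInf hsub), fun K => ⟨?_, ?_⟩, fun K hK =>
    ⟨⟨?_, ?_⟩, hleast K hK⟩⟩
  · rintro _ ⟨⟨K, v⟩, hv, rfl⟩
    obtain ⟨u, G, hu, h⟩ := hle K v hv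
    refine le_trans (sInf_le ?_) h
    exact ⟨K, hv.1, u, G, hu, rfl⟩
  · rintro ⟨hK, u, G, hu, hmem, hlow⟩
    obtain ⟨v, hv, h⟩ := (hleast K hK u G hu).1
    refine ⟨v, hv, ⟨(K, v), hv, rfl⟩, ?_⟩
    rintro _ ⟨⟨K', v'⟩, hv', rfl⟩
    obtain ⟨u', G', hu', h'⟩ := hle K' v' hv'
    rw [← h]
    exact (hlow ⟨K', hv'.1, u', G', hu', rfl⟩).trans h'
  · rintro ⟨v, hv, -, hlow⟩
    obtain ⟨u, G, hu, h⟩ := hle K v hv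
    refine ⟨hv.1, u, G, hu, ⟨K, hv.1, u, G, hu, rfl⟩, fun c hc => h.trans (hlow (hsub hc))⟩
  · rintro ⟨u, G, hu⟩
    obtain ⟨v, hv, -⟩ := (hleast K hK u G hu).1
    exact ⟨v, hv⟩
  · rintro ⟨v, hv⟩
    exact hpot K v hv
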